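/- Let $p$ be a prime, $q$ a power of $p$, and $\mathbb{F}_q$ the field with $q$ elements. On $\mathbb{F}_q((T^{-1}))$ let $|0|=0$ and $|\xi|=q^{-N}$ for $\xi=\sum_{n\ge N}a_nT^{-n}$ with $a_N\neq 0$, and extend $|\cdot|$ (uniquely) to an algebraic closure of $\mathbb{F}_q((T^{-1}))$, which contains an algebraic closure $\overline{\mathbb{F}_q(T)}$ of $\mathbb{F}_q(T)$. The height $H(P)$ of $P\in(\mathbb{F}_q[T])[X]$ is the maximum of the absolute values of its coefficients. For $\alpha\in\overline{\mathbb{F}_q(T)}$, the height $H(\alpha)$ and the degree $\deg\alpha$ are the height and the degree in $X$ of its minimal polynomial, that is, of the unique non-constant, irreducible, primitive $P\in(\mathbb{F}_q[T])[X]$ with leading coefficient monic in $T$ and $P(\alpha)=0$. For $\xi\in\mathbb{F}_q((T^{-1}))$ and integers $n,H\ge 1$ put $$w_n(\xi,H)=\min\{|P(\xi)| : P\in(\mathbb{F}_q[T])[X],\ H(P)\le H,\ \deg_XP\le n,\ P(\xi)\ne 0\},$$ $$w_n^*(\xi,H)=\min\{|\xi-\alpha| : \alpha\in\overline{\mathbb{F}_q(T)},\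 H(\alpha)\le H,\ \deg\alpha\le n,\ \alpha\ne\xi\},$$ $$w_n(\xi)=\limsup_{H\to\infty}\frac{-\log w_n(\xi,H)}{\log H},\qquad w_n^*(\xi)=\limsup_{H\to\infty}\frac{-\log\bigl(H\,w_n^*(\xi,H)\bigr)}{\log H}.$$ Let $w$ be a real number with $w>(5+\sqrt{17})/2$ if $p\neq 2$, and $w>(9+\sqrt{65})/2$ if $p=2$. Let $b,c\in\mathbb{F}_q[T]$ be distinct polynomials of degree at least one. For $n\ge 1$ let $a_{n,w}=c$ if $n=\lfloor w^i\rfloor$ for some integer $i\ge 0$, and $a_{n,w}=b$ otherwise. Then the continued fraction $$\xi_w=[0,a_{1,w},a_{2,w},\ldots]=\cfrac{1}{a_{1,w}+\cfrac{1}{a_{2,w}+\cdots}}$$ converges in $\mathbb{F}_q((T^{-1}))$, and $$w_2^*(\xi_w)=w-1,\qquad w_2(\xi_w)=w;$$ consequently $w_2(\xi_w)-w_2^*(\xi_w)=1$. -/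

import Mathlib

namespace LaurentApprox

open Polynomial Filter Topology
open scoped Classical

noncomputable section

/-- The ring embedding of `F[T]` into the field `F((T⁻¹))`. A member of `LaurentSeries F` is a
Laurent series in `T⁻¹`: its coefficient of index `n` is the coefficient of `T ^ (-n)`.
Hence `T` is sent to the monomial of index `-1`. -/
def polyToLaurent (F : Type*) [Field F] : F[X] →+* LaurentSeries F :=
  Polynomial.eval₂RingHom HahnSeries.C (HahnSeries.single (-1 : ℤ) (1 : F))

/-- The absolute value on `F((T⁻¹))`, for `F` a field of `q` elements: `|0| = 0`, and
`|ξ| = q ^ (-N)` for `ξ = ∑_{n ≥ N} a_n T ^ (-n)` with `a_N ≠ 0`. -/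
def laurentAbs (F : Type*) [Field F] [Finite F] : AbsoluteValue (LaurentSeries F) ℝ where
  toFun ξ := if ξ = 0 then 0 else (Nat.card F : ℝ) ^ (-HahnSeries.order ξ)
  map_mul' x y := by
    by_cases hx : x = 0
    · simp [hx]
    by_cases hy : y = 0
    · simp [hy]
    have hq : (Nat.card F : ℝ) ≠ 0 := by exact_mod_cast Nat.card_pos.ne'
    rw [if_neg hx, if_neg hy, if_neg (mul_ne_zero hx hy), HahnSeries.order_mul hx hy, neg_add,
      zpow_add₀ hq]
  nonneg' x := by
    by_cases hx : x = 0
    · simp [hx]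
    · rw [if_neg hx]
      positivity
  eq_zero' x := by
    by_cases hx : x = 0
    · simp [hx]
    · have hq : (Nat.card F : ℝ) ≠ 0 := by exact_mod_cast Nat.card_pos.ne'
      simp only [hx, iff_false]
      exact zpow_ne_zero _ hq
  add_le' x y := by
    have hq : (1 : ℝ) ≤ Nat.card F := by exact_mod_cast Nat.card_pos
    by_cases hx : x = 0
    · simp [hx]
    by_cases hy : y = 0
    · simp [hy]
    have h1 : (0 : ℝ) ≤ (Nat.card F : ℝ) ^ (-HahnSeries.order x) := by positivity
    have h2 : (0 : ℝ) ≤ (Nat.card F : ℝ) ^ (-HahnSeries.order y) := by positivity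
    by_cases hxy : x + y = 0
    · rw [if_pos hxy, if_neg hx, if_neg hy]
      positivity
    rw [if_neg hx, if_neg hy, if_neg hxy]
    rcases min_le_iff.mp (HahnSeries.min_order_le_order_add hxy) with h | h
    · have := zpow_le_zpow_right₀ hq (neg_le_neg h)
      linarith
    · have := zpow_le_zpow_right₀ hq (neg_le_neg h)
      linarith

/-- The extension of the absolute value of `F((T⁻¹))` to its algebraic closure: the spectral norm,
which for a complete non-archimedean field is the unique extension. -/
def algAbs (F : Type*) [Field F] [Finite F] (x : AlgebraicClosure (LaurentSeries F)) : ℝ :=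
  letI : NormedField (LaurentSeries F) := (laurentAbs F).toNormedField
  spectralNorm (LaurentSeries F) (AlgebraicClosure (LaurentSeries F)) x

theorem algAbs_algebraMap {F : Type*} [Field F] [Finite F] (x : LaurentSeries F) :
    algAbs F (algebraMap _ _ x) = laurentAbs F x := by
  let _ : NormedField (LaurentSeries F) := (laurentAbs F).toNormedField
  exact spectralNorm_extends (K := LaurentSeries F)
    (L := AlgebraicClosure (LaurentSeries F)) x

/-- The embedding of `F[T]` into the algebraic closure of `F((T⁻¹))`. -/
def polyToAlg (F : Type*) [Field F] : F[X] →+* AlgebraicClosure (LaurentSeries F) :=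
  (algebraMap (LaurentSeries F) (AlgebraicClosure (LaurentSeries F))).comp (polyToLaurent F)

/-- The height of `P ∈ (F[T])[X]`: the maximum of the absolute values of its coefficients. -/
def height {F : Type*} [Field F] [Finite F] (P : F[X][X]) : ℝ :=
  (Finset.range (P.natDegree + 1)).sup' Finset.nonempty_range_add_one
    (fun i => laurentAbs F (polyToLaurent F (P.coeff i)))

/-- `P` is the minimal polynomial over `F[T]` of the element `α` of the algebraic closure of
`F((T⁻¹))`: it vanishes at `α` and is non-constant (in `X`), irreducible and primitive, with a
leading coefficient that is monic in `T`. Such a `P` exists if and only if `α` is algebraic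
over `F(T)`, and it is then unique. -/
def IsMinPoly {F : Type*} [Field F] (P : F[X][X])
    (α : AlgebraicClosure (LaurentSeries F)) : Prop :=
  0 < P.natDegree ∧ Irreducible P ∧ P.IsPrimitive ∧ P.leadingCoeff.Monic ∧
    P.eval₂ (polyToAlg F) α = 0

/-- `w_n(ξ, H)`: the minimum of the nonzero values `|P(ξ)|` over the `P ∈ (F[T])[X]` of height at
most `H` and degree at most `n`. -/
def mahlerMin {F : Type*} [Field F] [Finite F] (n : ℕ) (ξ : LaurentSeries F) (H : ℕ) : ℝ :=
  sInf {r : ℝ | ∃ P : F[X][X], height P ≤ H ∧ P.natDegree ≤ n ∧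
    P.eval₂ (polyToLaurent F) ξ ≠ 0 ∧ r = laurentAbs F (P.eval₂ (polyToLaurent F) ξ)}

/-- `w_n^*(ξ, H)`: the minimum of `|ξ - α|` over the `α ≠ ξ` algebraic over `F(T)` whose height and
degree (those of the minimal polynomial) are at most `H` and `n`. -/
def koksmaMin {F : Type*} [Field F] [Finite F] (n : ℕ) (ξ : LaurentSeries F) (H : ℕ) : ℝ :=
  sInf {r : ℝ | ∃ (α : AlgebraicClosure (LaurentSeries F)) (P : F[X][X]), IsMinPoly P α ∧
    height P ≤ H ∧ P.natDegree ≤ n ∧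
    α ≠ algebraMap (LaurentSeries F) (AlgebraicClosure (LaurentSeries F)) ξ ∧
    r = algAbs F (algebraMap (LaurentSeries F) (AlgebraicClosure (LaurentSeries F)) ξ - α)}

/-- The exponent `w_n(ξ)`, with values in `[-∞, +∞]`. -/
def mahlerExp {F : Type*} [Field F] [Finite F] (n : ℕ) (ξ : LaurentSeries F) : EReal :=
  limsup (fun H : ℕ => ((-Real.log (mahlerMin n ξ H) / Real.log H : ℝ) : EReal)) atTop

/-- The exponent `w_n^*(ξ)`, with values in `[-∞, +∞]`. -/
def koksmaExp {F : Type*} [Field F] [Finite F] (n : ℕ) (ξ : LaurentSeries F) : EReal :=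
  limsup (fun H : ℕ => ((-Real.log (H * koksmaMin n ξ H) / Real.log H : ℝ) : EReal)) atTop

/-- The numerators `p_n` of the convergents of `[a 0, a 1, a 2, …]`. -/
def cfNum {F : Type*} [Field F] (a : ℕ → F[X]) : ℕ → F[X]
  | 0 => a 0
  | 1 => a 1 * a 0 + 1
  | n + 2 => a (n + 2) * cfNum a (n + 1) + cfNum a n

/-- The denominators `q_n` of the convergents of `[a 0, a 1, a 2, …]`. -/
def cfDen {F : Type*} [Field F] (a : ℕ → F[X]) : ℕ → F[X]
  | 0 => 1
  | 1 => a 1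
  | n + 2 => a (n + 2) * cfDen a (n + 1) + cfDen a n

/-- `ξ = [a 0, a 1, a 2, …]`: the convergents `p_n / q_n` converge to `ξ` in `F((T⁻¹))`. -/
def HasContFrac {F : Type*} [Field F] [Finite F] (a : ℕ → F[X]) (ξ : LaurentSeries F) : Prop :=
  Tendsto (fun n => laurentAbs F
    (ξ - polyToLaurent F (cfNum a n) / polyToLaurent F (cfDen a n))) atTop (𝓝 0)

theorem HasContFrac.unique {F : Type*} [Field F] [Finite F] {a : ℕ → F[X]}
    {ξ η : LaurentSeries F} (h₁ : HasContFrac a ξ) (h₂ : HasContFrac a η) : ξ = η := by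
  have h := Tendsto.add h₁ h₂
  rw [add_zero] at h
  have hle : laurentAbs F (ξ - η) ≤ 0 := by
    refine ge_of_tendsto h (Eventually.of_forall fun n => ?_)
    have h3 := (laurentAbs F).sub_le ξ
      (polyToLaurent F (cfNum a n) / polyToLaurent F (cfDen a n)) η
    rwa [(laurentAbs F).map_sub (polyToLaurent F (cfNum a n) / polyToLaurent F (cfDen a n)) η] at h3
  have h0 := le_antisymm hle ((laurentAbs F).nonneg _)
  exact sub_eq_zero.mp ((laurentAbs F).eq_zero.mp h0)

/-- The partial quotients: `0` at index `0`; for `n ≥ 1`, `c` if `n = ⌊w ^ i⌋` for some integer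
`i ≥ 0`, and `b` otherwise. -/
def partialQuot {F : Type*} [Field F] (w : ℝ) (b c : F[X]) (n : ℕ) : F[X] :=
  if n = 0 then 0 else if ∃ i : ℕ, n = ⌊w ^ i⌋₊ then c else b

end

end LaurentApprox

namespace LaurentApprox

open Polynomial Filter Topology
open scoped Classical

noncomputable section

section LaurentAbs

variable {F : Type*} [Field F]

/-! ### The embedding of polynomials -/

/-! Let `N i = ⌊w ^ (i + 1)⌋`, let p_n / q_n be the convergents of ξ and put H_i = |q_{N i}|².
Replacing every partial quotient after place `N i` by b gives a quadratic α_i close to ξ. A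
polynomial Q_i killing it is the norm form x² + bxy - y² at two consecutive linear forms q_k X -
p_k, with k + 1 = `N i`. Since consecutive convergents have determinant ±1, Q_i inherits the
properties of the form: it is primitive and irreducible, of discriminant exactly b² + 4
(`quadPoly_no_root`, `quadPoly_discrim`). Its height is comparable to H_i. The first disagreement
with ξ is at place `N (i + 1)`, which makes |Q_i(ξ)| comparable to 1 / H_{i+1}
(`laurentAbs_eval_quadPoly`), and log H_{i+1} is asymptotic to w log H_i. Hence w_2 ≥ w.

The gap 1 comes from the fixed discriminant: Q_i'(ξ)² = b² + 4 + 4 A Q_i(ξ), A being the leading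
coefficient, so |Q_i'(ξ)| stays bounded instead of growing like H_i. Thus |ξ - α_i| is of the size
of |Q_i(ξ)|, and the factor H in the definition of w_2^* costs exactly 1. As |b² + 4| = |b|² in
every characteristic, p = 2 is not exceptional here.

For the opposite bounds let P have degree at most 2 and height at most h. If P is not a multiple of
Q_i, the resultant of P and Q_i is a nonzero polynomial in T, of absolute value at least 1; written
at ξ, it forces |P(ξ)| ≫ 1 / (h H_i) as soon as h² H_i ≪ H_{i+1} (`ApproxSystem.liouville`). The
least such i has log H_i at most about (2w / (w - 1)) log h, and 2w / (w - 1) < w - 2 amounts to w²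
- 5w + 2 > 0 (`exists_index`). So |P(ξ)| ≫ h^{-(w-1)}, which even after division by h does not beat
the Q_i (`ApproxSystem.exists_value_bound`). -/

theorem polyToLaurent_monomial (k : ℕ) (a : F) :
    polyToLaurent F (Polynomial.monomial k a) = HahnSeries.single (-(k : ℤ)) a := by
  simp [polyToLaurent, HahnSeries.single_pow, HahnSeries.C_apply, HahnSeries.single_mul_single]

theorem polyToLaurent_coeff_neg (P : F[X]) (n : ℕ) :
    (polyToLaurent F P).coeff (-(n : ℤ)) = P.coeff n := by
  induction P using Polynomial.induction_on' with
  | add p q hp hq => simp [map_add, hp, hq]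
  | monomial k a =>
    simp [polyToLaurent_monomial, HahnSeries.coeff_single, Polynomial.coeff_monomial, eq_comm]

theorem polyToLaurent_coeff_pos (P : F[X]) {n : ℤ} (hn : 0 < n) :
    (polyToLaurent F P).coeff n = 0 := by
  induction P using Polynomial.induction_on' with
  | add p q hp hq => simp [map_add, hp, hq]
  | monomial k a =>
    rw [polyToLaurent_monomial, HahnSeries.coeff_single, if_neg (by omega)]

theorem polyToLaurent_injective : Function.Injective (polyToLaurent F) := by
  intro P Q h
  ext n
  rw [← polyToLaurent_coeff_neg, h, polyToLaurent_coeff_neg]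

/-- The finite continued fraction `[a 0, …, a m]`. -/
def finiteContFrac : ℕ → (ℕ → F[X]) → LaurentSeries F
  | 0, a => polyToLaurent F (a 0)
  | m + 1, a => polyToLaurent F (a 0) + (finiteContFrac m fun n => a (n + 1))⁻¹

theorem finiteContFrac_succ (m : ℕ) (a : ℕ → F[X]) :
    finiteContFrac (m + 1) a =
      polyToLaurent F (a 0) + (finiteContFrac m fun n => a (n + 1))⁻¹ :=
  rfl

variable [Finite F]

/-! ### The absolute value -/

theorem one_lt_card_real (F : Type*) [Field F] [Finite F] : (1 : ℝ) < Nat.card F := by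
  exact_mod_cast Finite.one_lt_card

theorem laurentAbs_of_ne_zero {x : LaurentSeries F} (hx : x ≠ 0) :
    laurentAbs F x = (Nat.card F : ℝ) ^ (-HahnSeries.order x) :=
  if_neg hx

theorem laurentAbs_le_zpow_iff (x : LaurentSeries F) (N : ℤ) :
    laurentAbs F x ≤ (Nat.card F : ℝ) ^ (-N) ↔ ∀ m < N, x.coeff m = 0 := by
  have hq := one_lt_card_real F
  by_cases hx : x = 0
  · subst hx
    simp only [map_zero, HahnSeries.coeff_zero, implies_true, iff_true]
    positivity
  rw [laurentAbs_of_ne_zero hx, zpow_le_zpow_iff_right₀ hq, neg_le_neg_iff,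
    HahnSeries.le_order_iff_forall hx]

theorem laurentAbs_add_le_max (x y : LaurentSeries F) :
    laurentAbs F (x + y) ≤ max (laurentAbs F x) (laurentAbs F y) := by
  have hq := one_lt_card_real F
  by_cases hx : x = 0
  · simp [hx]
  by_cases hy : y = 0
  · simp [hy]
  by_cases hxy : x + y = 0
  · rw [hxy, map_zero]
    exact le_max_of_le_left ((laurentAbs F).nonneg _)
  rw [laurentAbs_of_ne_zero hx, laurentAbs_of_ne_zero hy, laurentAbs_of_ne_zero hxy, le_max_iff,
    zpow_le_zpow_iff_right₀ hq, zpow_le_zpow_iff_right₀ hq, neg_le_neg_iff, neg_le_neg_iff]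
  exact min_le_iff.mp (HahnSeries.min_order_le_order_add hxy)

theorem laurentAbs_add_le {x y : LaurentSeries F} {r : ℝ} (hx : laurentAbs F x ≤ r)
    (hy : laurentAbs F y ≤ r) : laurentAbs F (x + y) ≤ r :=
  (laurentAbs_add_le_max x y).trans (max_le hx hy)

theorem laurentAbs_sub_le {x y : LaurentSeries F} {r : ℝ} (hx : laurentAbs F x ≤ r)
    (hy : laurentAbs F y ≤ r) : laurentAbs F (x - y) ≤ r := by
  rw [sub_eq_add_neg]
  exact laurentAbs_add_le hx (by rwa [(laurentAbs F).map_neg])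

theorem laurentAbs_add_eq_left {x y : LaurentSeries F} (h : laurentAbs F y < laurentAbs F x) :
    laurentAbs F (x + y) = laurentAbs F x := by
  refine le_antisymm (laurentAbs_add_le le_rfl h.le) ?_
  by_contra! h'
  have h1 : laurentAbs F (x + y - y) ≤ max (laurentAbs F (x + y)) (laurentAbs F y) :=
    laurentAbs_sub_le (le_max_left _ _) (le_max_right _ _)
  rw [add_sub_cancel_right] at h1
  exact absurd h1 (not_le.mpr (max_lt h' h))

theorem laurentAbs_pos {x : LaurentSeries F} (hx : x ≠ 0) : 0 < laurentAbs F x :=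
  (laurentAbs F).pos hx

/-- The absolute value of `P(T)` in `F((T⁻¹))`. -/
def polyAbs (P : F[X]) : ℝ := laurentAbs F (polyToLaurent F P)

theorem polyAbs_of_ne_zero {P : F[X]} (hP : P ≠ 0) :
    polyAbs P = (Nat.card F : ℝ) ^ P.natDegree := by
  have hP' : polyToLaurent F P ≠ 0 := (map_ne_zero_iff _ polyToLaurent_injective).mpr hP
  have h : HahnSeries.order (polyToLaurent F P) = -(P.natDegree : ℤ) := by
    refine le_antisymm (HahnSeries.order_le_of_coeff_ne_zero ?_) ?_
    · rw [polyToLaurent_coeff_neg]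
      simpa using hP
    · rw [HahnSeries.le_order_iff_forall hP']
      intro m hm
      obtain hm0 | hm0 := lt_or_ge 0 m
      · exact polyToLaurent_coeff_pos P hm0
      obtain ⟨n, rfl⟩ : ∃ n : ℕ, m = -(n : ℤ) := ⟨m.natAbs, by omega⟩
      rw [polyToLaurent_coeff_neg]
      exact Polynomial.coeff_eq_zero_of_natDegree_lt (by omega)
  rw [polyAbs, laurentAbs_of_ne_zero hP', h, neg_neg, zpow_natCast]

@[simp] theorem polyAbs_zero : polyAbs (0 : F[X]) = 0 := by simp [polyAbs]

@[simp] theorem polyAbs_one : polyAbs (1 : F[X]) = 1 := by simp [polyAbs]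

@[simp] theorem polyAbs_mul (P Q : F[X]) : polyAbs (P * Q) = polyAbs P * polyAbs Q := by
  simp [polyAbs]

@[simp] theorem polyAbs_neg (P : F[X]) : polyAbs (-P) = polyAbs P := by
  simp [polyAbs, (laurentAbs F).map_neg]

theorem polyAbs_nonneg (P : F[X]) : 0 ≤ polyAbs P := (laurentAbs F).nonneg _

theorem one_le_polyAbs {P : F[X]} (hP : P ≠ 0) : 1 ≤ polyAbs P := by
  rw [polyAbs_of_ne_zero hP]
  exact one_le_pow₀ (one_lt_card_real F).le

theorem card_le_polyAbs {P : F[X]} (hP : 1 ≤ P.natDegree) : (Nat.card F : ℝ) ≤ polyAbs P := by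
  rw [polyAbs_of_ne_zero (by rintro rfl; simp at hP)]
  exact le_self_pow₀ (one_lt_card_real F).le (by omega)

theorem one_lt_polyAbs {P : F[X]} (hP : 1 ≤ P.natDegree) : 1 < polyAbs P :=
  (one_lt_card_real F).trans_le (card_le_polyAbs hP)

theorem two_le_polyAbs {P : F[X]} (hP : 1 ≤ P.natDegree) : 2 ≤ polyAbs P := by
  refine le_trans ?_ (card_le_polyAbs hP)
  exact_mod_cast Finite.one_lt_card (α := F)

theorem polyAbs_add_le {P Q : F[X]} {r : ℝ} (hP : polyAbs P ≤ r) (hQ : polyAbs Q ≤ r) :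
    polyAbs (P + Q) ≤ r := by
  rw [polyAbs, map_add]
  exact laurentAbs_add_le hP hQ

theorem polyAbs_sub_le {P Q : F[X]} {r : ℝ} (hP : polyAbs P ≤ r) (hQ : polyAbs Q ≤ r) :
    polyAbs (P - Q) ≤ r := by
  rw [polyAbs, map_sub]
  exact laurentAbs_sub_le hP hQ

theorem polyAbs_add_eq_left {P Q : F[X]} (h : polyAbs Q < polyAbs P) :
    polyAbs (P + Q) = polyAbs P := by
  rw [polyAbs, map_add]
  exact laurentAbs_add_eq_left h

/-! ### Completeness -/

/-- The coefficient of index k is the same in all `s m` with m > k, so the limit can be read off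
coefficient by coefficient. -/
theorem exists_laurentAbs_limit (s : ℕ → LaurentSeries F)
    (hs : ∀ m : ℕ, laurentAbs F (s (m + 1) - s m) ≤ (Nat.card F : ℝ) ^ (-(m : ℤ))) :
    ∃ L : LaurentSeries F, ∀ m : ℕ, laurentAbs F (L - s m) ≤ (Nat.card F : ℝ) ^ (-(m : ℤ)) := by
  have hcoeff : ∀ (k : ℤ) (m j : ℕ), k < m → (s (m + j)).coeff k = (s m).coeff k := by
    intro k m j hk
    induction j with
    | zero => rfl
    | succ j ih =>
      have := (laurentAbs_le_zpow_iff _ _).mp (hs (m + j)) k (by push_cast; omega)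
      rw [HahnSeries.coeff_sub, sub_eq_zero] at this
      rw [← ih, ← this]
      rfl
  -- For k ≤ -1 the stage `(k + 1).toNat` is 0, so far to the left only the coefficients of `s 0`
  -- occur.
  have hbd : BddBelow (Function.support fun k : ℤ => (s (k + 1).toNat).coeff k) := by
    refine ⟨min (-1) (s 0).order, fun k hk => ?_⟩
    by_contra! hlt
    refine hk ?_
    have h0 : (k + 1).toNat = 0 := by omega
    simp only [h0]
    exact HahnSeries.coeff_eq_zero_of_lt_order (by omega)
  refine ⟨HahnSeries.ofSuppBddBelow _ hbd, fun m => ?_⟩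
  rw [laurentAbs_le_zpow_iff]
  intro k hk
  rw [HahnSeries.coeff_sub, HahnSeries.coeff_ofSuppBddBelow, sub_eq_zero]
  obtain ⟨j, hj⟩ := Nat.exists_eq_add_of_le (show (k + 1).toNat ≤ m by omega)
  rw [hj]
  exact (hcoeff k _ j (by omega)).symm

/-! ### Continued fractions -/

theorem laurentAbs_inv_lt_one {x : LaurentSeries F} (hx : 1 < laurentAbs F x) :
    laurentAbs F x⁻¹ < 1 := by
  rw [map_inv₀]
  exact inv_lt_one_of_one_lt₀ hx

theorem laurentAbs_finiteContFrac (m : ℕ) (a : ℕ → F[X]) (ha : ∀ n, 1 ≤ (a n).natDegree) :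
    laurentAbs F (finiteContFrac m a) = polyAbs (a 0) := by
  induction m generalizing a with
  | zero => rfl
  | succ m ih =>
    refine laurentAbs_add_eq_left (lt_trans (laurentAbs_inv_lt_one ?_) (one_lt_polyAbs (ha 0)))
    rw [ih _ fun n => ha (n + 1)]
    exact one_lt_polyAbs (ha 1)

theorem inv_sub_inv_laurentAbs {x y : LaurentSeries F} (hx : x ≠ 0) (hy : y ≠ 0) :
    laurentAbs F (x⁻¹ - y⁻¹) = laurentAbs F (x - y) / (laurentAbs F x * laurentAbs F y) := by
  rw [inv_sub_inv hx hy, map_div₀, map_mul, (laurentAbs F).map_sub]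

/-- Inversion divides distances by |x||y| = |a 1|², which is at least the cardinality of F, so each
level of nesting gains one power of it. -/
theorem laurentAbs_finiteContFrac_sub (m : ℕ) (a : ℕ → F[X]) (ha : ∀ n, 1 ≤ (a n).natDegree) :
    laurentAbs F (finiteContFrac (m + 1) a - finiteContFrac m a) ≤
      (Nat.card F : ℝ) ^ (-(m : ℤ)) := by
  have hq := one_lt_card_real F
  induction m generalizing a with
  | zero =>
    simp only [finiteContFrac, add_sub_cancel_left]
    simpa using (laurentAbs_inv_lt_one (one_lt_polyAbs (ha 1))).le
  | succ m ih =>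
    have ha' : ∀ n, 1 ≤ (a (n + 1)).natDegree := fun n => ha (n + 1)
    have hne : ∀ k, finiteContFrac k (fun n => a (n + 1)) ≠ 0 := fun k h => by
      have := laurentAbs_finiteContFrac k _ ha'
      rw [h, map_zero] at this
      linarith [one_lt_polyAbs (ha 1)]
    rw [finiteContFrac_succ (m + 1) a, finiteContFrac_succ m a, add_sub_add_left_eq_sub,
      inv_sub_inv_laurentAbs (hne _) (hne _), laurentAbs_finiteContFrac _ _ ha',
      laurentAbs_finiteContFrac _ _ ha']
    have h1 := ih _ ha'
    have h2 := card_le_polyAbs (ha 1)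
    have h3 : (Nat.card F : ℝ) ≤ polyAbs (a 1) * polyAbs (a 1) := by nlinarith
    calc _ ≤ (Nat.card F : ℝ) ^ (-(m : ℤ)) / Nat.card F := by gcongr
      _ = _ := by
        rw [Nat.cast_succ, neg_add, zpow_add₀ (by positivity), zpow_neg_one, div_eq_mul_inv]

theorem eq_zero_of_laurentAbs_le {x : LaurentSeries F}
    (h : ∀ m : ℕ, laurentAbs F x ≤ (Nat.card F : ℝ) ^ (-(m : ℤ))) : x = 0 := by
  ext k
  exact (laurentAbs_le_zpow_iff x _).mp (h (k + 1).toNat) k (by omega)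

/-- The value of the infinite continued fraction. -/
theorem exists_contFrac_value (F : Type*) [Field F] [Finite F] :
    ∃ L : (ℕ → F[X]) → LaurentSeries F, ∀ a, (∀ n, 1 ≤ (a n).natDegree) →
      laurentAbs F (L a) = polyAbs (a 0) ∧
      L a = polyToLaurent F (a 0) + (L fun n => a (n + 1))⁻¹ := by
  -- The value 0 for inadmissible sequences makes `L` total, so that it can be applied to every
  -- tail.
  have key : ∀ a : ℕ → F[X], ∃ x : LaurentSeries F, (∀ n, 1 ≤ (a n).natDegree) →
      ∀ m : ℕ, laurentAbs F (x - finiteContFrac m a) ≤ (Nat.card F : ℝ) ^ (-(m : ℤ)) := by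
    intro a
    by_cases ha : ∀ n, 1 ≤ (a n).natDegree
    · obtain ⟨x, hx⟩ := exists_laurentAbs_limit (fun m => finiteContFrac m a)
        fun m => laurentAbs_finiteContFrac_sub m a ha
      exact ⟨x, fun _ => hx⟩
    · exact ⟨0, fun h => absurd h ha⟩
  choose L hL using key
  have habs : ∀ a, (∀ n, 1 ≤ (a n).natDegree) → laurentAbs F (L a) = polyAbs (a 0) := by
    intro a ha
    have h1 := hL a ha 0
    have h2 := one_lt_polyAbs (ha 0)
    have h3 := laurentAbs_add_eq_left (x := finiteContFrac 0 a) (y := L a - finiteContFrac 0 a)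
      (by rw [laurentAbs_finiteContFrac _ _ ha]; exact lt_of_le_of_lt (by simpa using h1) h2)
    rw [add_sub_cancel, laurentAbs_finiteContFrac _ _ ha] at h3
    exact h3
  refine ⟨L, fun a ha => ⟨habs a ha, sub_eq_zero.mp (eq_zero_of_laurentAbs_le fun m => ?_)⟩⟩
  have ha' : ∀ n, 1 ≤ (a (n + 1)).natDegree := fun n => ha (n + 1)
  have hq := one_lt_card_real F
  have h1 : laurentAbs F (L a - finiteContFrac (m + 1) a) ≤ (Nat.card F : ℝ) ^ (-(m : ℤ)) :=
    (hL a ha (m + 1)).trans (zpow_le_zpow_right₀ hq.le (by push_cast; omega))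
  have h2 : laurentAbs F ((finiteContFrac m fun n => a (n + 1))⁻¹ - (L fun n => a (n + 1))⁻¹) ≤
      (Nat.card F : ℝ) ^ (-(m : ℤ)) := by
    have hp := one_lt_polyAbs (ha 1)
    have e1 := laurentAbs_finiteContFrac m _ ha'
    have e2 := habs _ ha'
    rw [inv_sub_inv_laurentAbs, e1, e2, (laurentAbs F).map_sub]
    · refine (div_le_self ((laurentAbs F).nonneg _) ?_).trans (hL _ ha' m)
      simp only [zero_add]
      nlinarith
    · intro h
      rw [h, map_zero] at e1
      simp only [zero_add] at e1
      linarith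
    · intro h
      rw [h, map_zero] at e2
      simp only [zero_add] at e2
      linarith
  have := laurentAbs_add_le h1 h2
  rw [finiteContFrac] at this
  convert this using 2
  ring

end LaurentAbs

/-! ### Convergents -/

section Convergents

variable {F : Type*} [Field F]

theorem cfNum_mul_cfDen_sub (a : ℕ → F[X]) (n : ℕ) :
    cfNum a (n + 1) * cfDen a n - cfNum a n * cfDen a (n + 1) = (-1) ^ n := by
  induction n with
  | zero => simp [cfNum, cfDen]; ring
  | succ n ih =>
    rw [cfNum, cfDen, pow_succ, ← ih]
    ring

theorem cfNum_mul_cfDen_sub_sq (a : ℕ → F[X]) (n : ℕ) :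
    (cfNum a (n + 1) * cfDen a n - cfNum a n * cfDen a (n + 1)) ^ 2 = 1 := by
  rw [cfNum_mul_cfDen_sub, ← pow_mul, mul_comm, pow_mul, neg_one_sq, one_pow]

variable [Finite F] {a : ℕ → F[X]}

theorem cfDen_step (ha : ∀ n, 1 ≤ (a (n + 1)).natDegree) (n : ℕ) :
    polyAbs (cfDen a (n + 1)) = polyAbs (a (n + 1)) * polyAbs (cfDen a n) ∧
      0 < polyAbs (cfDen a n) := by
  induction n with
  | zero => simp [cfDen]
  | succ n ih =>
    obtain ⟨ih, hpos⟩ := ih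
    have h1 := one_lt_polyAbs (ha n)
    have h2 := one_lt_polyAbs (ha (n + 1))
    have hpos' : 0 < polyAbs (cfDen a (n + 1)) := by rw [ih]; positivity
    refine ⟨?_, hpos'⟩
    rw [cfDen, polyAbs_add_eq_left, polyAbs_mul]
    rw [polyAbs_mul, ih]
    have h3 : polyAbs (cfDen a n) < polyAbs (a (n + 1)) * polyAbs (cfDen a n) :=
      lt_mul_of_one_lt_left hpos h1
    exact h3.trans (lt_mul_of_one_lt_left (hpos.trans h3) h2)

theorem polyAbs_cfDen_succ (ha : ∀ n, 1 ≤ (a (n + 1)).natDegree) (n : ℕ) :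
    polyAbs (cfDen a (n + 1)) = polyAbs (a (n + 1)) * polyAbs (cfDen a n) :=
  (cfDen_step ha n).1

theorem polyAbs_cfDen_pos (ha : ∀ n, 1 ≤ (a (n + 1)).natDegree) (n : ℕ) :
    0 < polyAbs (cfDen a n) :=
  (cfDen_step ha n).2

theorem polyAbs_cfDen_lt_succ (ha : ∀ n, 1 ≤ (a (n + 1)).natDegree) (n : ℕ) :
    polyAbs (cfDen a n) < polyAbs (cfDen a (n + 1)) := by
  rw [polyAbs_cfDen_succ ha]
  exact lt_mul_of_one_lt_left (polyAbs_cfDen_pos ha n) (one_lt_polyAbs (ha n))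

theorem two_pow_le_polyAbs_cfDen (ha : ∀ n, 1 ≤ (a (n + 1)).natDegree) (n : ℕ) :
    2 ^ n ≤ polyAbs (cfDen a n) := by
  induction n with
  | zero => simp [cfDen]
  | succ n ih =>
    rw [polyAbs_cfDen_succ ha, pow_succ, mul_comm]
    exact mul_le_mul (two_le_polyAbs (ha n)) ih (by positivity) (polyAbs_nonneg _)

theorem polyAbs_cfNum_le (ha : ∀ n, 1 ≤ (a (n + 1)).natDegree) (ha0 : a 0 = 0) (n : ℕ) :
    polyAbs (cfNum a n) ≤ polyAbs (cfDen a n) := by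
  induction n using Nat.strong_induction_on with
  | _ n ih =>
    match n with
    | 0 => simp [cfNum, cfDen, ha0]
    | 1 => simpa [cfNum, cfDen, ha0] using (one_lt_polyAbs (ha 0)).le
    | n + 2 =>
      rw [cfNum]
      refine polyAbs_add_le ?_ ?_
      · rw [polyAbs_mul, polyAbs_cfDen_succ ha]
        exact mul_le_mul_of_nonneg_left (ih _ (by omega)) (polyAbs_nonneg _)
      · exact (ih n (by omega)).trans
          ((polyAbs_cfDen_lt_succ ha n).trans (polyAbs_cfDen_lt_succ ha _)).le

/-- Convergence of the continued fraction, with the exact quality of the convergents. -/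
theorem exists_hasContFrac (ha : ∀ n, 1 ≤ (a (n + 1)).natDegree) (ha0 : a 0 = 0) :
    ∃ ξ : LaurentSeries F, HasContFrac a ξ ∧ laurentAbs F ξ < 1 ∧
      ∀ n, laurentAbs F (polyToLaurent F (cfDen a n) * ξ - polyToLaurent F (cfNum a n)) =
        (polyAbs (cfDen a (n + 1)))⁻¹ := by
  obtain ⟨L, hL⟩ := exists_contFrac_value F
  -- `x n` is the complete quotient [a (n+1), a (n+2), …]; as `a 0 = 0`, the value sought is 1 / `x
  -- 0`.
  set x : ℕ → LaurentSeries F := fun n => L fun m => a (n + m + 1) with hx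
  have hx1 : ∀ n, laurentAbs F (x n) = polyAbs (a (n + 1)) := fun n => (hL _ fun m => ha _).1
  have hx2 : ∀ n, x n = polyToLaurent F (a (n + 1)) + (x (n + 1))⁻¹ := fun n => by
    have := (hL (fun m => a (n + m + 1)) fun m => ha _).2
    simp only [hx]
    convert this using 6
    ring
  have hx0 : ∀ n, x n ≠ 0 := fun n h => by
    have := hx1 n
    rw [h, map_zero] at this
    linarith [one_lt_polyAbs (ha n)]
  set u : ℕ → LaurentSeries F := fun n =>
    polyToLaurent F (cfDen a n) * (x 0)⁻¹ - polyToLaurent F (cfNum a n) with hu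
  -- `u` obeys the recurrence of the convergents, so each step divides |u| by |`x (n + 1)`| = |a (n
  -- + 2)|.
  have hstep : ∀ n, u (n + 1) = -u n * (x (n + 1))⁻¹ := by
    intro n
    induction n with
    | zero =>
      have h0 : (x 1)⁻¹ = x 0 - polyToLaurent F (a 1) := by rw [hx2 0]; ring
      simp only [hu, cfDen, cfNum, ha0, zero_add, map_one, map_zero, mul_zero, h0]
      field_simp [hx0 0]
      ring
    | succ n ih =>
      have h0 : (x (n + 2))⁻¹ = x (n + 1) - polyToLaurent F (a (n + 2)) := by
        rw [hx2 (n + 1)]; ring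
      have h1 : u n = -u (n + 1) * x (n + 1) := by
        rw [ih]; field_simp [hx0 (n + 1)]
      have h2 : u (n + 2) = polyToLaurent F (a (n + 2)) * u (n + 1) + u n := by
        simp only [hu, cfDen, cfNum, map_add, map_mul]
        ring
      rw [show n + 1 + 1 = n + 2 from rfl, h2, h0, h1]
      ring
  have habs : ∀ n, laurentAbs F (u n) = (polyAbs (cfDen a (n + 1)))⁻¹ := by
    intro n
    induction n with
    | zero => simp [hu, cfDen, cfNum, ha0, hx1]
    | succ n ih =>
      rw [hstep, map_mul, (laurentAbs F).map_neg, ih, map_inv₀, hx1, polyAbs_cfDen_succ ha (n + 1),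
        mul_inv, mul_comm]
  refine ⟨(x 0)⁻¹, ?_, ?_, habs⟩
  · have hlim : Tendsto (fun n : ℕ => ((1 : ℝ) / 2) ^ n) atTop (𝓝 0) :=
      tendsto_pow_atTop_nhds_zero_of_lt_one (by norm_num) (by norm_num)
    refine squeeze_zero (fun n => (laurentAbs F).nonneg _) (fun n => ?_) hlim
    have hpos := polyAbs_cfDen_pos ha n
    have hd : polyToLaurent F (cfDen a n) ≠ 0 := fun h => by
      rw [polyAbs, h, map_zero] at hpos
      exact lt_irrefl _ hpos
    have h1 : (x 0)⁻¹ - polyToLaurent F (cfNum a n) / polyToLaurent F (cfDen a n) =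
        u n / polyToLaurent F (cfDen a n) := by
      simp only [hu]
      field_simp
    rw [h1, map_div₀, habs]
    have h2 := two_pow_le_polyAbs_cfDen ha n
    have h3 : 1 ≤ polyAbs (cfDen a (n + 1)) :=
      (one_le_pow₀ one_le_two).trans (two_pow_le_polyAbs_cfDen ha (n + 1))
    calc (polyAbs (cfDen a (n + 1)))⁻¹ / polyAbs (cfDen a n)
        ≤ 1 / polyAbs (cfDen a n) := by gcongr; exact inv_le_one_of_one_le₀ h3
      _ ≤ 1 / 2 ^ n := by gcongr
      _ = _ := by rw [one_div_pow]
  · refine laurentAbs_inv_lt_one ?_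
    rw [hx1]
    exact one_lt_polyAbs (ha 0)

/-- The purely periodic continued fraction `[b, b, …]` lies in `F((T⁻¹))`. -/
theorem exists_sq_eq_mul_add_one {b : F[X]} (hb : 1 ≤ b.natDegree) :
    ∃ β : LaurentSeries F, β ^ 2 = polyToLaurent F b * β + 1 := by
  obtain ⟨L, hL⟩ := exists_contFrac_value F
  obtain ⟨h1, h2⟩ := hL (fun _ => b) fun _ => hb
  refine ⟨L fun _ => b, ?_⟩
  have h0 : (L fun _ => b) ≠ 0 := fun h => by
    rw [h, map_zero] at h1
    linarith [one_lt_polyAbs hb]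
  set y := L fun _ => b with hy
  have h3 : y * y = (polyToLaurent F b + y⁻¹) * y := by rw [← h2]
  rw [sq, h3, add_mul, inv_mul_cancel₀ h0]

end Convergents

/-! ### The quadratic form `x² + bxy - y²` and the approximating quadratic polynomials -/

section QuadForm

/-- The norm form `x² + bxy - y²`. -/
def normForm {R : Type*} [CommRing R] (b x y : R) : R := x ^ 2 + b * x * y - y ^ 2

/-- The quadratic polynomial annihilating `[a 0, …, a (k + 1), b, b, …]`. -/
def quadPoly {F : Type*} [Field F] (b : F[X]) (a : ℕ → F[X]) (k : ℕ) : F[X][X] :=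
  C (normForm b (cfDen a k) (cfDen a (k + 1))) * X ^ 2 +
    C (2 * cfDen a (k + 1) * cfNum a (k + 1) - 2 * cfDen a k * cfNum a k -
      b * (cfDen a k * cfNum a (k + 1) + cfDen a (k + 1) * cfNum a k)) * X +
    C (normForm b (cfNum a k) (cfNum a (k + 1)))

variable {F : Type*} [Field F]

theorem eval₂_quadPoly {R : Type*} [CommRing R] (φ : F[X] →+* R) (b : F[X]) (a : ℕ → F[X])
    (k : ℕ) (x : R) :
    (quadPoly b a k).eval₂ φ x = normForm (φ b) (φ (cfDen a k) * x - φ (cfNum a k))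
      (φ (cfDen a (k + 1)) * x - φ (cfNum a (k + 1))) := by
  simp only [quadPoly, eval₂_add, eval₂_mul, eval₂_C, eval₂_X, eval₂_pow]
  simp only [normForm, map_add, map_sub, map_mul, map_pow, map_ofNat]
  ring

theorem quadPoly_coeff_two (b : F[X]) (a : ℕ → F[X]) (k : ℕ) :
    (quadPoly b a k).coeff 2 = normForm b (cfDen a k) (cfDen a (k + 1)) := by
  simp [quadPoly]

theorem quadPoly_coeff_one (b : F[X]) (a : ℕ → F[X]) (k : ℕ) :
    (quadPoly b a k).coeff 1 = 2 * cfDen a (k + 1) * cfNum a (k + 1) -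
      2 * cfDen a k * cfNum a k -
      b * (cfDen a k * cfNum a (k + 1) + cfDen a (k + 1) * cfNum a k) := by
  simp [quadPoly, coeff_C]

theorem quadPoly_coeff_zero (b : F[X]) (a : ℕ → F[X]) (k : ℕ) :
    (quadPoly b a k).coeff 0 = normForm b (cfNum a k) (cfNum a (k + 1)) := by
  simp [quadPoly]

theorem quadPoly_natDegree_le (b : F[X]) (a : ℕ → F[X]) (k : ℕ) :
    (quadPoly b a k).natDegree ≤ 2 := natDegree_quadratic_le

/-- The discriminant b² + 4 of the norm form gets multiplied by the square of the determinant of the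
substitution, which is 1. Its independence of k is what controls the derivative at ξ. -/
theorem quadPoly_discrim (b : F[X]) (a : ℕ → F[X]) (k : ℕ) :
    (quadPoly b a k).coeff 1 ^ 2 - 4 * (quadPoly b a k).coeff 2 * (quadPoly b a k).coeff 0 =
      b ^ 2 + 4 := by
  rw [quadPoly_coeff_zero, quadPoly_coeff_one, quadPoly_coeff_two]
  calc _ = (b ^ 2 + 4) *
        (cfNum a (k + 1) * cfDen a k - cfNum a k * cfDen a (k + 1)) ^ 2 := by
          unfold normForm; ring
    _ = _ := by rw [cfNum_mul_cfDen_sub_sq, mul_one]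

/-- The polynomial does not change, up to sign, when the expansion is continued with `b`. -/
theorem quadPoly_succ {b : F[X]} {a : ℕ → F[X]} {k : ℕ} (h : a (k + 2) = b) :
    quadPoly b a (k + 1) = -quadPoly b a k := by
  simp only [quadPoly, normForm, cfNum, cfDen, h]
  simp only [map_add, map_sub, map_mul, map_pow, map_ofNat]
  ring

/-- Along a run of b's the polynomial can be moved from the start of the run, where its height is
known, to the end, where its value at ξ is known. -/
theorem quadPoly_add {b : F[X]} {a : ℕ → F[X]} (k d : ℕ)
    (h : ∀ j, k ≤ j → j < k + d → a (j + 2) = b) :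
    quadPoly b a (k + d) = quadPoly b a k ∨ quadPoly b a (k + d) = -quadPoly b a k := by
  induction d with
  | zero => exact Or.inl rfl
  | succ d ih =>
    rw [← add_assoc, quadPoly_succ (h (k + d) (by omega) (by omega))]
    rcases ih fun j h1 h2 => h j h1 (by omega) with h | h
    · exact Or.inr (by rw [h])
    · exact Or.inl (by rw [h, neg_neg])

/-- After division by the gcd, x' divides y'² and y' divides x'², so both are units; then b x' y' =
y'² - x'² has degree 0, against deg b ≥ 1. -/
theorem normForm_anisotropic {b : F[X]} (hb : 1 ≤ b.natDegree) {x y : F[X]}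
    (h : normForm b x y = 0) : x = 0 ∧ y = 0 := by
  by_cases hy : y = 0
  · subst hy
    simpa [normForm] using h
  exfalso
  obtain ⟨x', hx'⟩ := EuclideanDomain.gcd_dvd_left x y
  obtain ⟨y', hy'⟩ := EuclideanDomain.gcd_dvd_right x y
  have hg : EuclideanDomain.gcd x y ≠ 0 := fun h0 => hy (by rw [hy', h0, zero_mul])
  have hco : IsCoprime x' y' := by
    obtain ⟨u, v, huv⟩ : ∃ u v, u * x + v * y = EuclideanDomain.gcd x y :=
      ⟨EuclideanDomain.gcdA x y, EuclideanDomain.gcdB x y, by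
        linear_combination -EuclideanDomain.gcd_eq_gcd_ab x y⟩
    refine ⟨u, v, mul_left_cancel₀ hg ?_⟩
    calc _ = u * (EuclideanDomain.gcd x y * x') + v * (EuclideanDomain.gcd x y * y') := by ring
      _ = _ := by rw [← hx', ← hy', huv, mul_one]
  have h' : normForm b x' y' = 0 := by
    refine (mul_eq_zero.mp (?_ : EuclideanDomain.gcd x y ^ 2 * normForm b x' y' = 0)).resolve_left
      (pow_ne_zero 2 hg)
    calc _ = normForm b (EuclideanDomain.gcd x y * x') (EuclideanDomain.gcd x y * y') := by
          unfold normForm; ring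
      _ = _ := by rw [← hx', ← hy', h]
  unfold normForm at h'
  have hux : IsUnit x' := (hco.pow_right (n := 2)).isUnit_of_dvd' dvd_rfl
    ⟨x' + b * y', by linear_combination -h'⟩
  have huy : IsUnit y' := (hco.symm.pow_right (n := 2)).isUnit_of_dvd' dvd_rfl
    ⟨y' - b * x', by linear_combination h'⟩
  have e1 := natDegree_eq_zero_of_isUnit hux
  have e2 := natDegree_eq_zero_of_isUnit huy
  have h3 : b * (x' * y') = y' ^ 2 - x' ^ 2 := by linear_combination h'
  have h4 : b ≠ 0 := by rintro rfl; simp at hb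
  have h5 := congrArg natDegree h3
  rw [natDegree_mul h4 (hux.mul huy).ne_zero, natDegree_mul hux.ne_zero huy.ne_zero, e1, e2] at h5
  have h6 := natDegree_sub_le (y' ^ 2) (x' ^ 2)
  rw [natDegree_pow, natDegree_pow, e1, e2] at h6
  simp at h6
  omega

/-- The expression is the norm form at the image of (s, r) under the matrix of convergents.
Anisotropy makes the image zero, and the matrix is invertible because its determinant D has D² = 1.
-/
theorem quadPoly_no_root {b : F[X]} (hb : 1 ≤ b.natDegree) (a : ℕ → F[X]) (k : ℕ) {r s : F[X]}
    (h : (quadPoly b a k).coeff 2 * s ^ 2 - (quadPoly b a k).coeff 1 * r * s +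
      (quadPoly b a k).coeff 0 * r ^ 2 = 0) : r = 0 ∧ s = 0 := by
  rw [quadPoly_coeff_zero, quadPoly_coeff_one, quadPoly_coeff_two] at h
  have h' : normForm b (cfDen a k * s + cfNum a k * r)
      (cfDen a (k + 1) * s + cfNum a (k + 1) * r) = 0 := by
    rw [← h]; unfold normForm; ring
  obtain ⟨h1, h2⟩ := normForm_anisotropic hb h'
  have hdet := cfNum_mul_cfDen_sub_sq a k
  set D := cfNum a (k + 1) * cfDen a k - cfNum a k * cfDen a (k + 1) with hD
  constructor
  · linear_combination -r * hdet + D * cfDen a k * h2 - D * cfDen a (k + 1) * h1 +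
      D * r * hD
  · linear_combination -s * hdet - D * cfNum a k * h2 + D * cfNum a (k + 1) * h1 +
      D * s * hD

theorem quadPoly_lead_ne_zero {b : F[X]} (hb : 1 ≤ b.natDegree) (a : ℕ → F[X]) (k : ℕ) :
    (quadPoly b a k).coeff 2 ≠ 0 := fun h => by
  have := (quadPoly_no_root hb a k (r := 0) (s := 1) (by simp [h])).2
  exact one_ne_zero this

theorem quadPoly_natDegree {b : F[X]} (hb : 1 ≤ b.natDegree) (a : ℕ → F[X]) (k : ℕ) :
    (quadPoly b a k).natDegree = 2 :=
  le_antisymm (quadPoly_natDegree_le b a k)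
    (le_natDegree_of_ne_zero (quadPoly_lead_ne_zero hb a k))

/-- At X = p_{k+1} / q_{k+1} the second linear form vanishes and the first becomes ±1 after clearing
denominators; so the coefficients have a combination equal to 1. -/
theorem quadPoly_isPrimitive (b : F[X]) (a : ℕ → F[X]) (k : ℕ) :
    (quadPoly b a k).IsPrimitive := by
  intro r hr
  rw [C_dvd_iff_dvd_coeff] at hr
  have hdet := cfNum_mul_cfDen_sub_sq a k
  refine isUnit_of_dvd_one ?_
  have h1 : (quadPoly b a k).coeff 2 * cfNum a (k + 1) ^ 2 +
      (quadPoly b a k).coeff 1 * (cfNum a (k + 1) * cfDen a (k + 1)) +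
      (quadPoly b a k).coeff 0 * cfDen a (k + 1) ^ 2 = 1 := by
    rw [quadPoly_coeff_zero, quadPoly_coeff_one, quadPoly_coeff_two, ← hdet]
    unfold normForm
    ring
  rw [← h1]
  exact dvd_add (dvd_add ((hr 2).mul_right _) ((hr 1).mul_right _)) ((hr 0).mul_right _)

/-- Primitivity excludes nonunit constant factors, and a linear factor r X + s would give a zero
forbidden by `quadPoly_no_root`. -/
theorem quadPoly_irreducible {b : F[X]} (hb : 1 ≤ b.natDegree) (a : ℕ → F[X]) (k : ℕ) :
    Irreducible (quadPoly b a k) := by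
  have hdeg := quadPoly_natDegree hb a k
  have hne : quadPoly b a k ≠ 0 := by
    intro h
    rw [h] at hdeg
    simp at hdeg
  have hconst : ∀ f g : F[X][X], quadPoly b a k = f * g → f.natDegree = 0 → IsUnit f := by
    intro f g hfg hf
    rw [eq_C_of_natDegree_eq_zero hf] at hfg ⊢
    exact (quadPoly_isPrimitive b a k _ ⟨g, hfg⟩).map C
  refine ⟨fun hu => ?_, fun f g hfg => ?_⟩
  · rw [natDegree_eq_zero_of_isUnit hu] at hdeg
    omega
  have hf0 : f ≠ 0 := by rintro rfl; simp at hfg; exact hne hfg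
  have hg0 : g ≠ 0 := by rintro rfl; simp at hfg; exact hne hfg
  have hsum : f.natDegree + g.natDegree = 2 := by
    rw [← natDegree_mul hf0 hg0, ← hfg, hdeg]
  rcases Nat.eq_zero_or_pos f.natDegree with h0 | h0
  · exact Or.inl (hconst f g hfg h0)
  rcases Nat.eq_zero_or_pos g.natDegree with h1 | h1
  · exact Or.inr (hconst g f (by rw [hfg, mul_comm]) h1)
  exfalso
  have hf := eq_X_add_C_of_natDegree_le_one (show f.natDegree ≤ 1 by omega)
  have hg := eq_X_add_C_of_natDegree_le_one (show g.natDegree ≤ 1 by omega)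
  have hr : f.coeff 1 ≠ 0 := by
    rw [← show f.natDegree = 1 by omega]
    simpa using hf0
  have hexp : quadPoly b a k = C (f.coeff 1 * g.coeff 1) * X ^ 2 +
      C (f.coeff 1 * g.coeff 0 + f.coeff 0 * g.coeff 1) * X + C (f.coeff 0 * g.coeff 0) := by
    rw [hfg]
    nth_rw 1 [hf, hg]
    simp only [map_add, map_mul]
    ring
  refine hr (quadPoly_no_root hb a k (r := f.coeff 1) (s := f.coeff 0) ?_).1
  rw [hexp]
  simp only [coeff_add, coeff_C_mul, coeff_X_pow, coeff_X, coeff_C]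
  norm_num
  ring

theorem eq_quadratic {R : Type*} [CommRing R] {P : R[X]} (hP : P.natDegree ≤ 2) :
    P = C (P.coeff 2) * X ^ 2 + C (P.coeff 1) * X + C (P.coeff 0) := by
  refine (as_sum_range' P 3 (by omega)).trans ?_
  simp only [← C_mul_X_pow_eq_monomial]
  rw [Finset.sum_range_succ, Finset.sum_range_succ, Finset.sum_range_one]
  simp only [pow_zero, pow_one, mul_one]
  ring

theorem eval₂_quadratic {R S : Type*} [CommRing R] [CommRing S] {P : R[X]} (φ : R →+* S)
    (hP : P.natDegree ≤ 2) (x : S) :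
    P.eval₂ φ x = φ (P.coeff 2) * x ^ 2 + φ (P.coeff 1) * x + φ (P.coeff 0) := by
  rw [eval₂_eq_sum_range' φ (show P.natDegree < 3 by omega), Finset.sum_range_succ,
    Finset.sum_range_succ, Finset.sum_range_one]
  simp only [pow_zero, pow_one, mul_one]
  ring

/-- The resultant of two polynomials of formal degree two. -/
def quadResultant {R : Type*} [CommRing R] (x y z A B C : R) : R :=
  (x * C - z * A) ^ 2 - (x * B - y * A) * (y * C - z * B)

/-- Invariance under X ↦ X + t. At t = ξ the coefficients become the leading coefficient, the
derivative at ξ and the value at ξ. -/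
theorem quadResultant_translate {R : Type*} [CommRing R] (x y z A B C t : R) :
    quadResultant x y z A B C = quadResultant x (2 * x * t + y) (x * t ^ 2 + y * t + z)
      A (2 * A * t + B) (A * t ^ 2 + B * t + C) := by
  unfold quadResultant
  ring

/-- A quadratic polynomial with vanishing resultant is a multiple of `quadPoly`. -/
theorem exists_eq_C_mul_quadPoly {b : F[X]} (hb : 1 ≤ b.natDegree) (a : ℕ → F[X]) (k : ℕ)
    {P : F[X][X]} (hP : P.natDegree ≤ 2)
    (h : quadResultant (P.coeff 2) (P.coeff 1) (P.coeff 0) ((quadPoly b a k).coeff 2)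
      ((quadPoly b a k).coeff 1) ((quadPoly b a k).coeff 0) = 0) :
    ∃ d : F[X], P = C d * quadPoly b a k := by
  set Q := quadPoly b a k with hQ
  have hA : Q.coeff 2 ≠ 0 := quadPoly_lead_ne_zero hb a k
  obtain ⟨hr, hs⟩ := quadPoly_no_root hb a k
    -- The leading coefficient of Q times the resultant is the form of `quadPoly_no_root` at this r
    -- and s.
    (r := P.coeff 1 * Q.coeff 2 - P.coeff 2 * Q.coeff 1)
    (s := P.coeff 0 * Q.coeff 2 - P.coeff 2 * Q.coeff 0) (by
      rw [← hQ, ← mul_eq_zero_of_right (Q.coeff 2) h]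
      unfold quadResultant
      ring)
  have hmul : C (Q.coeff 2) * P = C (P.coeff 2) * Q := by
    have e1 := eq_quadratic hP
    have e2 := eq_quadratic (quadPoly_natDegree_le b a k)
    rw [← hQ] at e2
    have hr' := congrArg C hr
    have hs' := congrArg C hs
    simp only [map_sub, map_mul, map_zero] at hr' hs'
    linear_combination C (Q.coeff 2) * e1 - C (P.coeff 2) * e2 + hr' * X + hs'
  have hirr : Irreducible Q := quadPoly_irreducible hb a k
  have hdeg : Q.natDegree = 2 := quadPoly_natDegree hb a k
  -- Q is prime and, having degree 2, cannot divide the nonzero constant `C (Q.coeff 2)`; hence it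
  -- divides P.
  rcases hirr.prime.dvd_or_dvd ⟨_, by rw [hmul, mul_comm]⟩ with hd | ⟨S, hS⟩
  · have := natDegree_le_of_dvd hd (by simpa using hA)
    rw [hdeg, natDegree_C] at this
    omega
  by_cases hS0 : S = 0
  · exact ⟨0, by rw [hS, hS0]; simp⟩
  have hS1 : S.natDegree = 0 := by
    have := congrArg natDegree hS
    rw [natDegree_mul hirr.ne_zero hS0, hdeg] at this
    omega
  exact ⟨S.coeff 0, by rw [← eq_C_of_natDegree_eq_zero hS1, mul_comm, hS]⟩

/-- The normalization of `quadPoly` that makes the leading coefficient monic. -/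
def monicQuadPoly (b : F[X]) (a : ℕ → F[X]) (k : ℕ) : F[X][X] :=
  C (C ((quadPoly b a k).coeff 2).leadingCoeff⁻¹) * quadPoly b a k

theorem isMinPoly_monicQuadPoly {b : F[X]} (hb : 1 ≤ b.natDegree) (a : ℕ → F[X]) (k : ℕ)
    {α : AlgebraicClosure (LaurentSeries F)} (hα : (quadPoly b a k).eval₂ (polyToAlg F) α = 0) :
    IsMinPoly (monicQuadPoly b a k) α := by
  have hA := quadPoly_lead_ne_zero hb a k
  have hl : ((quadPoly b a k).coeff 2).leadingCoeff ≠ 0 := by simpa using hA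
  have hu : IsUnit (C (C ((quadPoly b a k).coeff 2).leadingCoeff⁻¹) : F[X][X]) :=
    ((isUnit_iff_ne_zero.mpr (inv_ne_zero hl)).map C).map C
  have hass : Associated (quadPoly b a k) (monicQuadPoly b a k) :=
    (associated_isUnit_mul_left_iff hu).mpr (Associated.refl _) |>.symm
  have hdeg : (monicQuadPoly b a k).natDegree = 2 := by
    rw [monicQuadPoly, natDegree_mul hu.ne_zero (quadPoly_irreducible hb a k).ne_zero,
      natDegree_C, quadPoly_natDegree hb, zero_add]
  refine ⟨by omega, hass.irreducible (quadPoly_irreducible hb a k), ?_, ?_, ?_⟩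
  · intro r hr
    exact quadPoly_isPrimitive b a k r (hr.trans hass.symm.dvd)
  · rw [leadingCoeff, hdeg, monicQuadPoly, coeff_C_mul, Monic, leadingCoeff_mul, leadingCoeff_C,
      inv_mul_cancel₀ hl]
  · rw [monicQuadPoly, eval₂_mul, hα, mul_zero]

end QuadForm

/-! ### Size of the approximating polynomials -/

section Approximation

variable {F : Type*} [Field F] [Finite F]

theorem laurentAbs_sub_lt {x y : LaurentSeries F} {r : ℝ} (hx : laurentAbs F x < r)
    (hy : laurentAbs F y < r) : laurentAbs F (x - y) < r :=
  (laurentAbs_sub_le (le_max_left _ _) (le_max_right _ _)).trans_lt (max_lt hx hy)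

theorem polyAbs_natCast_le (n : ℕ) : polyAbs (n : F[X]) ≤ 1 := by
  induction n with
  | zero => simp
  | succ n ih =>
    rw [Nat.cast_succ]
    exact polyAbs_add_le ih polyAbs_one.le

theorem polyAbs_ofNat_le (n : ℕ) [n.AtLeastTwo] : polyAbs (OfNat.ofNat n : F[X]) ≤ 1 :=
  polyAbs_natCast_le n

theorem polyAbs_normForm_le {b x y : F[X]} {r : ℝ} (hb : 1 ≤ polyAbs b) (hx : polyAbs x ≤ r)
    (hy : polyAbs y ≤ r) : polyAbs (normForm b x y) ≤ polyAbs b * r ^ 2 := by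
  have hr : 0 ≤ r := (polyAbs_nonneg x).trans hx
  have h0 := polyAbs_nonneg x
  have h1 := polyAbs_nonneg y
  have hxx : polyAbs x * polyAbs x ≤ r * r := mul_le_mul hx hx h0 hr
  have hxy : polyAbs x * polyAbs y ≤ r * r := mul_le_mul hx hy h1 hr
  have hyy : polyAbs y * polyAbs y ≤ r * r := mul_le_mul hy hy h1 hr
  have hrr : r * r ≤ polyAbs b * r ^ 2 := by nlinarith [mul_nonneg hr hr]
  unfold normForm
  refine polyAbs_sub_le (polyAbs_add_le ?_ ?_) ?_
  · rw [sq, polyAbs_mul]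
    linarith
  · rw [polyAbs_mul, polyAbs_mul, mul_assoc, sq]
    gcongr
  · rw [sq, polyAbs_mul]
    linarith

variable {a : ℕ → F[X]} {b c : F[X]}

theorem polyAbs_quadPoly_coeff_le (ha : ∀ n, 1 ≤ (a (n + 1)).natDegree) (ha0 : a 0 = 0)
    (hb : 1 ≤ b.natDegree) (k j : ℕ) :
    polyAbs ((quadPoly b a k).coeff j) ≤ polyAbs b * polyAbs (cfDen a (k + 1)) ^ 2 := by
  have hb1 := (one_lt_polyAbs hb).le
  have h1 : polyAbs (cfDen a k) ≤ polyAbs (cfDen a (k + 1)) := (polyAbs_cfDen_lt_succ ha k).le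
  have h2 := polyAbs_cfNum_le ha ha0 (k + 1)
  have h3 := (polyAbs_cfNum_le ha ha0 k).trans h1
  set r := polyAbs (cfDen a (k + 1)) with hr
  have hr0 : 0 ≤ r := polyAbs_nonneg _
  have hprod : ∀ {x y z : F[X]}, polyAbs x ≤ polyAbs b → polyAbs y ≤ r → polyAbs z ≤ r →
      polyAbs (x * (y * z)) ≤ polyAbs b * r ^ 2 := by
    intro x y z hx hy hz
    rw [polyAbs_mul, polyAbs_mul, sq]
    exact mul_le_mul hx (mul_le_mul hy hz (polyAbs_nonneg _) hr0)
      (mul_nonneg (polyAbs_nonneg _) (polyAbs_nonneg _)) (polyAbs_nonneg _)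
  match j with
  | 0 =>
    rw [quadPoly_coeff_zero]
    exact polyAbs_normForm_le hb1 h3 h2
  | 1 =>
    have htwo : polyAbs (2 : F[X]) ≤ polyAbs b := (polyAbs_ofNat_le 2).trans hb1
    rw [quadPoly_coeff_one, mul_assoc, mul_assoc, mul_add]
    exact polyAbs_sub_le (polyAbs_sub_le (hprod htwo le_rfl h2) (hprod htwo h1 h3))
      (polyAbs_add_le (hprod le_rfl h1 h2) (hprod le_rfl le_rfl h3))
  | 2 =>
    rw [quadPoly_coeff_two]
    exact polyAbs_normForm_le hb1 h1 le_rfl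
  | j + 3 =>
    rw [coeff_eq_zero_of_natDegree_lt (lt_of_le_of_lt (quadPoly_natDegree_le b a k) (by omega)),
      polyAbs_zero]
    positivity

/-- With last partial quotient c the product (b - c) q_{k+1} q_{k+2} dominates. A last quotient b
would cancel it, so the height is measured right after a c. -/
theorem polyAbs_quadPoly_lead (ha : ∀ n, 1 ≤ (a (n + 1)).natDegree) (hbc : b ≠ c) {k : ℕ}
    (hk : a (k + 2) = c) :
    polyAbs ((quadPoly b a (k + 1)).coeff 2) =
      polyAbs (b - c) * (polyAbs (cfDen a (k + 1)) * polyAbs (cfDen a (k + 2))) := by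
  have h1 := one_le_polyAbs (sub_ne_zero.mpr hbc)
  have p0 := polyAbs_cfDen_pos ha k
  have p1 := polyAbs_cfDen_lt_succ ha k
  have p2 := polyAbs_cfDen_lt_succ ha (k + 1)
  have e : (quadPoly b a (k + 1)).coeff 2 = (b - c) * (cfDen a (k + 1) * cfDen a (k + 2)) +
      (cfDen a (k + 1) * cfDen a (k + 1) - cfDen a (k + 2) * cfDen a k) := by
    rw [quadPoly_coeff_two, normForm]
    have : cfDen a (k + 2) = c * cfDen a (k + 1) + cfDen a k := by rw [cfDen, hk]
    rw [show k + 1 + 1 = k + 2 from rfl, this]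
    ring
  have hpos : 0 < polyAbs (cfDen a (k + 1)) * polyAbs (cfDen a (k + 2)) := by
    have := p0.trans p1
    have := this.trans p2
    positivity
  rw [e, polyAbs_add_eq_left, polyAbs_mul, polyAbs_mul]
  rw [polyAbs_mul, polyAbs_mul]
  refine lt_of_lt_of_le ?_ (le_mul_of_one_le_left hpos.le h1)
  have hlt := max_lt (mul_lt_mul_of_pos_left p2 (p0.trans p1))
    (show polyAbs (cfDen a (k + 2)) * polyAbs (cfDen a k) <
      polyAbs (cfDen a (k + 1)) * polyAbs (cfDen a (k + 2)) by nlinarith)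
  refine lt_of_le_of_lt (polyAbs_sub_le ?_ ?_) hlt
  · rw [polyAbs_mul]
    exact le_max_left _ _
  · rw [polyAbs_mul]
    exact le_max_right _ _

variable {ξ : LaurentSeries F}

/-- Place k + 2 is where the expansion of ξ has c instead of the b of the periodic tail. Inserting
u_{k+2} = c u_{k+1} + u_k into the norm form leaves the dominant term (b - c) u_k u_{k+1}. -/
theorem laurentAbs_eval_quadPoly (ha : ∀ n, 1 ≤ (a (n + 1)).natDegree) (hbc : b ≠ c)
    (hξ : ∀ n, laurentAbs F (polyToLaurent F (cfDen a n) * ξ - polyToLaurent F (cfNum a n)) =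
      (polyAbs (cfDen a (n + 1)))⁻¹) {k : ℕ} (hk : a (k + 2) = c) :
    laurentAbs F ((quadPoly b a k).eval₂ (polyToLaurent F) ξ) =
      polyAbs (b - c) * polyAbs c / polyAbs (cfDen a (k + 2)) ^ 2 := by
  have h1 := one_le_polyAbs (sub_ne_zero.mpr hbc)
  have p1 := polyAbs_cfDen_pos ha (k + 1)
  have p2 := polyAbs_cfDen_lt_succ ha (k + 1)
  have p3 := polyAbs_cfDen_lt_succ ha (k + 2)
  have hc : polyAbs (cfDen a (k + 2)) = polyAbs c * polyAbs (cfDen a (k + 1)) := by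
    rw [polyAbs_cfDen_succ ha (k + 1), hk]
  set u : ℕ → LaurentSeries F := fun n =>
    polyToLaurent F (cfDen a n) * ξ - polyToLaurent F (cfNum a n) with hu
  have hu' : ∀ n, laurentAbs F (u n) = (polyAbs (cfDen a (n + 1)))⁻¹ := hξ
  have e : (quadPoly b a k).eval₂ (polyToLaurent F) ξ =
      polyToLaurent F (b - c) * (u k * u (k + 1)) + (u k * u (k + 2) - u (k + 1) * u (k + 1)) := by
    have : u (k + 2) = polyToLaurent F c * u (k + 1) + u k := by
      simp only [hu, cfDen, cfNum, map_add, map_mul, hk]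
      ring
    rw [eval₂_quadPoly, this, map_sub]
    simp only [normForm, hu]
    ring
  have hpos : 0 < laurentAbs F (u k * u (k + 1)) := by
    rw [map_mul, hu', hu']
    have := p1.trans p2
    positivity
  rw [e, laurentAbs_add_eq_left]
  · rw [map_mul, map_mul, hu', hu', hc]
    change polyAbs (b - c) * _ = _
    have hc0 : polyAbs c ≠ 0 := by
      intro h
      rw [h, zero_mul] at hc
      linarith
    field_simp
  · rw [map_mul]
    refine lt_of_lt_of_le ?_ (le_mul_of_one_le_left hpos.le h1)
    refine laurentAbs_sub_lt ?_ ?_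
    · rw [map_mul, map_mul, hu', hu', hu']
      have h4 : (polyAbs (cfDen a (k + 3)))⁻¹ < (polyAbs (cfDen a (k + 2)))⁻¹ :=
        inv_strictAnti₀ (p1.trans p2) p3
      exact mul_lt_mul_of_pos_left h4 (inv_pos.mpr p1)
    · rw [map_mul, map_mul, hu', hu']
      have h4 : (polyAbs (cfDen a (k + 2)))⁻¹ < (polyAbs (cfDen a (k + 1)))⁻¹ :=
        inv_strictAnti₀ p1 p2
      exact mul_lt_mul_of_pos_right h4 (inv_pos.mpr (p1.trans p2))

end Approximation

/-! ### A Liouville-type inequality -/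

section Liouville

variable {F : Type*} [Field F] [Finite F]

theorem polyAbs_coeff_le_height (P : F[X][X]) (i : ℕ) : polyAbs (P.coeff i) ≤ height P := by
  have hle : ∀ j ≤ P.natDegree, polyAbs (P.coeff j) ≤ height P := fun j hj =>
    Finset.le_sup' (fun i => laurentAbs F (polyToLaurent F (P.coeff i)))
      (Finset.mem_range.mpr (by omega))
  by_cases hi : i ≤ P.natDegree
  · exact hle i hi
  · rw [coeff_eq_zero_of_natDegree_lt (by omega), polyAbs_zero]
    exact (polyAbs_nonneg _).trans (hle 0 (Nat.zero_le _))

theorem height_le {P : F[X][X]} {r : ℝ} (h : ∀ i, polyAbs (P.coeff i) ≤ r) : height P ≤ r :=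
  Finset.sup'_le _ _ fun i _ => h i

theorem height_C_mul_quadPoly_leading {b : F[X]} {a : ℕ → F[X]} {k : ℕ} (d : F[X]) :
    polyAbs d * polyAbs ((quadPoly b a k).coeff 2) ≤ height (C d * quadPoly b a k) := by
  rw [← polyAbs_mul, ← coeff_C_mul]
  exact polyAbs_coeff_le_height _ _

/-- A sequence of quadratic polynomials `quadPoly b a (k i)` of heights comparable to `H i` with
values at `ξ` comparable to `1 / H (i + 1)`. -/
structure ApproxSystem (b : F[X]) (a : ℕ → F[X]) (ξ : LaurentSeries F) (M : ℝ) (k : ℕ → ℕ)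
    (H : ℕ → ℝ) : Prop where
  one_le_const : 1 ≤ M
  degree_pos : 1 ≤ b.natDegree
  abs_le_one : laurentAbs F ξ ≤ 1
  one_le : ∀ i, 1 ≤ H i
  coeff_le : ∀ i j, polyAbs ((quadPoly b a (k i)).coeff j) ≤ M * H i
  le_lead : ∀ i, H i ≤ M * polyAbs ((quadPoly b a (k i)).coeff 2)
  eval_le : ∀ i, laurentAbs F ((quadPoly b a (k i)).eval₂ (polyToLaurent F) ξ) ≤ M / H (i + 1)
  le_eval : ∀ i, 1 / (M * H (i + 1)) ≤
    laurentAbs F ((quadPoly b a (k i)).eval₂ (polyToLaurent F) ξ)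
  deriv_le : ∀ i, laurentAbs F (2 * polyToLaurent F ((quadPoly b a (k i)).coeff 2) * ξ +
    polyToLaurent F ((quadPoly b a (k i)).coeff 1)) ≤ M

theorem laurentAbs_deriv_le {ξ : LaurentSeries F} (hξ : laurentAbs F ξ ≤ 1) {x y : F[X]} {h : ℝ}
    (hx : polyAbs x ≤ h) (hy : polyAbs y ≤ h) :
    laurentAbs F (2 * polyToLaurent F x * ξ + polyToLaurent F y) ≤ h := by
  refine laurentAbs_add_le ?_ hy
  rw [map_mul, map_mul]
  have h2 : laurentAbs F 2 ≤ 1 := by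
    have := polyAbs_ofNat_le (F := F) 2
    rwa [polyAbs, map_ofNat] at this
  calc laurentAbs F 2 * laurentAbs F (polyToLaurent F x) * laurentAbs F ξ
      ≤ 1 * laurentAbs F (polyToLaurent F x) * 1 := by
        gcongr
    _ ≤ h := by rw [one_mul, mul_one]; exact hx

namespace ApproxSystem

variable {a : ℕ → F[X]} {b : F[X]} {ξ : LaurentSeries F} {M : ℝ} {k : ℕ → ℕ} {H : ℕ → ℝ}

theorem eval_pos (S : ApproxSystem b a ξ M k H) (i : ℕ) :
    0 < laurentAbs F ((quadPoly b a (k i)).eval₂ (polyToLaurent F) ξ) := by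
  refine lt_of_lt_of_le ?_ (S.le_eval i)
  have h1 := S.one_le_const
  have h2 := S.one_le (i + 1)
  positivity

/-- The resultant of P and Q, if nonzero, has absolute value at least 1. Translated to ξ, its terms
containing Q(ξ) are small by `hi`, and the others contain P(ξ), which therefore cannot be small. -/
theorem liouville (S : ApproxSystem b a ξ M k H) {P : F[X][X]} (hP : P.natDegree ≤ 2) {h : ℝ}
    (hh : 1 ≤ h) (hPh : height P ≤ h) {i : ℕ} (hi : M ^ 2 * h ^ 2 * H i < H (i + 1)) :
    (∃ d, P = C d * quadPoly b a (k i)) ∨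
      1 / (M ^ 2 * h * H i) ≤ laurentAbs F (P.eval₂ (polyToLaurent F) ξ) := by
  by_contra! hcon
  obtain ⟨hdvd, hlt⟩ := hcon
  have hM := S.one_le_const
  have hH := S.one_le i
  have hH' := S.one_le (i + 1)
  have hPc : ∀ j, polyAbs (P.coeff j) ≤ h := fun j => (polyAbs_coeff_le_height P j).trans hPh
  set Q := quadPoly b a (k i) with hQ
  have hres : quadResultant (P.coeff 2) (P.coeff 1) (P.coeff 0) (Q.coeff 2) (Q.coeff 1)
      (Q.coeff 0) ≠ 0 := fun h0 => by
    obtain ⟨d, hd⟩ := exists_eq_C_mul_quadPoly S.degree_pos a (k i) hP h0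
    exact hdvd d hd
  have hres1 := one_le_polyAbs hres
  have hEv := S.eval_le i
  have hD := S.deriv_le i
  have hQc := S.coeff_le i
  rw [← hQ] at hEv hD hQc
  have hQ2 : Q.natDegree ≤ 2 := quadPoly_natDegree_le _ _ _
  have hPD := laurentAbs_deriv_le S.abs_le_one (hPc 2) (hPc 1)
  have htr := quadResultant_translate (polyToLaurent F (P.coeff 2)) (polyToLaurent F (P.coeff 1))
    (polyToLaurent F (P.coeff 0)) (polyToLaurent F (Q.coeff 2)) (polyToLaurent F (Q.coeff 1))
    (polyToLaurent F (Q.coeff 0)) ξ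
  rw [← eval₂_quadratic _ hP, ← eval₂_quadratic _ hQ2] at htr
  set e := P.eval₂ (polyToLaurent F) ξ
  set E := Q.eval₂ (polyToLaurent F) ξ
  set dP := 2 * polyToLaurent F (P.coeff 2) * ξ + polyToLaurent F (P.coeff 1)
  set dQ := 2 * polyToLaurent F (Q.coeff 2) * ξ + polyToLaurent F (Q.coeff 1)
  have hlt' : laurentAbs F e * (M ^ 2 * h * H i) < 1 := by
    rwa [lt_div_iff₀ (by positivity)] at hlt
  have e0 := (laurentAbs F).nonneg e
  have hkey : h * M * H i * (h * (M / H (i + 1))) < 1 := by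
    rw [show h * M * H i * (h * (M / H (i + 1))) = M ^ 2 * h ^ 2 * H i / H (i + 1) by ring,
      div_lt_one (by positivity)]
    exact hi
  have hHi : 1 ≤ h * M * H i := one_le_mul_of_one_le_of_one_le
    (one_le_mul_of_one_le_of_one_le hh hM) hH
  -- The bounds `b1` to `b4` control the 2 × 2 minors that make up the translated resultant.
  have b1 : laurentAbs F (polyToLaurent F (P.coeff 2) * E) < 1 := by
    rw [map_mul]
    calc _ ≤ h * (M / H (i + 1)) := mul_le_mul (hPc 2) hEv ((laurentAbs F).nonneg _) (by positivity)
      _ ≤ h * M * H i * (h * (M / H (i + 1))) := le_mul_of_one_le_left (by positivity) hHi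
      _ < 1 := hkey
  have b2 : laurentAbs F (e * polyToLaurent F (Q.coeff 2)) < 1 := by
    rw [map_mul]
    calc _ ≤ laurentAbs F e * (M * H i) := mul_le_mul_of_nonneg_left (hQc 2) e0
      _ ≤ laurentAbs F e * (M * H i) * (M * h) :=
        le_mul_of_one_le_right (by positivity) (one_le_mul_of_one_le_of_one_le hM hh)
      _ = laurentAbs F e * (M ^ 2 * h * H i) := by ring
      _ < 1 := hlt'
  have b3 : laurentAbs F (polyToLaurent F (P.coeff 2) * dQ - dP * polyToLaurent F (Q.coeff 2)) ≤
      h * M * H i := by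
    refine laurentAbs_sub_le ?_ ?_
    · rw [map_mul]
      calc _ ≤ h * M := mul_le_mul (hPc 2) hD ((laurentAbs F).nonneg _) (by positivity)
        _ ≤ h * M * H i := le_mul_of_one_le_right (by positivity) hH
    · rw [map_mul, mul_assoc]
      exact mul_le_mul hPD (hQc 2) ((laurentAbs F).nonneg _) (by positivity)
  have b4 : laurentAbs F (dP * E - e * dQ) ≤ max (h * (M / H (i + 1))) (laurentAbs F e * M) := by
    refine laurentAbs_sub_le (le_max_of_le_left ?_) (le_max_of_le_right ?_)
    · rw [map_mul]
      exact mul_le_mul hPD hEv ((laurentAbs F).nonneg _) (by positivity)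
    · rw [map_mul]
      exact mul_le_mul_of_nonneg_left hD e0
  refine absurd hres1 (not_le.mpr ?_)
  have hmap : polyToLaurent F (quadResultant (P.coeff 2) (P.coeff 1) (P.coeff 0) (Q.coeff 2)
      (Q.coeff 1) (Q.coeff 0)) = quadResultant (polyToLaurent F (P.coeff 2)) dP e
      (polyToLaurent F (Q.coeff 2)) dQ E := by
    rw [← htr]
    simp only [quadResultant, map_sub, map_mul, map_pow]
  rw [polyAbs, hmap, quadResultant]
  refine laurentAbs_sub_lt ?_ ?_
  · rw [map_pow]
    exact pow_lt_one₀ ((laurentAbs F).nonneg _) (laurentAbs_sub_lt b1 b2) two_ne_zero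
  · rw [map_mul]
    calc _ ≤ h * M * H i * max (h * (M / H (i + 1))) (laurentAbs F e * M) :=
          mul_le_mul b3 b4 ((laurentAbs F).nonneg _) (by positivity)
      _ < 1 := by
        rw [mul_max_of_nonneg _ _ (by positivity)]
        refine max_lt hkey ?_
        calc _ = laurentAbs F e * (M ^ 2 * h * H i) := by ring
          _ < 1 := hlt'

end ApproxSystem

end Liouville

/-! ### The sparse sequence of partial quotients -/

section SparseSequence

theorem floor_pow_bounds {w : ℝ} (hw : 4 < w) (i : ℕ) :
    w ^ (i + 1) - 1 < (⌊w ^ (i + 1)⌋₊ : ℝ) ∧ (⌊w ^ (i + 1)⌋₊ : ℝ) ≤ w ^ (i + 1) :=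
  ⟨by linarith [Nat.lt_floor_add_one (w ^ (i + 1))], Nat.floor_le (by positivity)⟩

theorem four_le_floor_pow {w : ℝ} (hw : 4 < w) (i : ℕ) : 4 ≤ ⌊w ^ (i + 1)⌋₊ := by
  refine Nat.le_floor ?_
  push_cast
  exact hw.le.trans (le_self_pow₀ (by linarith) (by omega))

theorem floor_pow_lt_succ {w : ℝ} (hw : 4 < w) (i : ℕ) :
    ⌊w ^ (i + 1)⌋₊ < ⌊w ^ (i + 1 + 1)⌋₊ := by
  have h1 := (floor_pow_bounds hw i).2
  have h2 := (floor_pow_bounds hw (i + 1)).1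
  have h3 : (1 : ℝ) ≤ w ^ (i + 1) := one_le_pow₀ (by linarith)
  have h4 : w ^ (i + 1 + 1) = w ^ (i + 1) * w := pow_succ _ _
  have h5 : (⌊w ^ (i + 1)⌋₊ : ℝ) < ⌊w ^ (i + 1 + 1)⌋₊ := by nlinarith
  exact_mod_cast h5

theorem sq_le_floor_pow {w : ℝ} (hw : 4 < w) (i : ℕ) :
    ((i : ℝ) + 1) ^ 2 ≤ ⌊w ^ (i + 1)⌋₊ := by
  have h1 : ∀ n : ℕ, (n + 1) ^ 2 + 1 ≤ 4 ^ (n + 1) := by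
    intro n
    induction n with
    | zero => norm_num
    | succ n ih => rw [pow_succ 4]; nlinarith
  have h2 : ((i : ℝ) + 1) ^ 2 + 1 ≤ 4 ^ (i + 1) := by exact_mod_cast h1 i
  have h3 : (4 : ℝ) ^ (i + 1) ≤ w ^ (i + 1) := pow_le_pow_left₀ (by norm_num) hw.le _
  linarith [(floor_pow_bounds hw i).1]

section

variable {F : Type*} [Field F] {w : ℝ} {b c : F[X]}

theorem partialQuot_zero : partialQuot w b c 0 = 0 := if_pos rfl

theorem partialQuot_degree (hb : 1 ≤ b.natDegree) (hc : 1 ≤ c.natDegree) (n : ℕ) :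
    1 ≤ (partialQuot w b c (n + 1)).natDegree := by
  unfold partialQuot
  rw [if_neg n.succ_ne_zero]
  split_ifs
  exacts [hc, hb]

theorem partialQuot_floor (hw : 4 < w) (i : ℕ) :
    partialQuot w b c ⌊w ^ (i + 1)⌋₊ = c := by
  have := four_le_floor_pow hw i
  rw [partialQuot, if_neg (by omega), if_pos ⟨_, rfl⟩]

theorem partialQuot_of_lt_of_lt (hw : 4 < w) {i n : ℕ} (h1 : ⌊w ^ (i + 1)⌋₊ < n)
    (h2 : n < ⌊w ^ (i + 1 + 1)⌋₊) : partialQuot w b c n = b := by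
  rw [partialQuot, if_neg (by omega), if_neg]
  rintro ⟨l, rfl⟩
  rcases le_or_gt l (i + 1) with hl | hl
  · exact absurd h1 (not_lt.mpr (Nat.floor_le_floor (pow_le_pow_right₀ (by linarith) hl)))
  · exact absurd h2 (not_lt.mpr (Nat.floor_le_floor (pow_le_pow_right₀ (by linarith) hl)))

end

/-- Telescoping gives ℓ i = lam · N i + O(i + 1), and N (i + 1) = w · N i + O(1). The error is thus
linear in i, and ℓ grows at least quadratically. -/
theorem exists_abs_sub_le {ℓ : ℕ → ℝ} {w lam mu : ℝ} (hw : 4 < w) (hlam : 0 ≤ lam)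
    (hrec : ∀ i, ℓ (i + 1) = ℓ i +
      ((⌊w ^ (i + 1 + 1)⌋₊ : ℝ) - ⌊w ^ (i + 1)⌋₊ - 1) * lam + mu)
    (hlow : ∀ i : ℕ, ((i : ℝ) + 1) ^ 2 ≤ 2 * ℓ i) {δ : ℝ} (hδ : 0 < δ) :
    ∃ K, ∀ i, |ℓ (i + 1) - w * ℓ i| ≤ δ * ℓ i + K := by
  set N : ℕ → ℝ := fun i => (⌊w ^ (i + 1)⌋₊ : ℝ) with hN
  set e := ℓ 0 - lam * N 0 with he
  have hform : ∀ i : ℕ, ℓ i = lam * N i + e + i * (mu - lam) := by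
    intro i
    induction i with
    | zero => simp [he]
    | succ i ih =>
      rw [hrec, ih]
      simp only [hN]
      push_cast
      ring
  set K := lam * w + (1 + w) * (|e| + |mu - lam|) with hK
  have hK0 : 0 ≤ K := by positivity
  have hlin : ∀ i : ℕ, |ℓ (i + 1) - w * ℓ i| ≤ K * (i + 1) := by
    intro i
    obtain ⟨a1, a2⟩ := floor_pow_bounds hw i
    obtain ⟨a3, a4⟩ := floor_pow_bounds hw (i + 1)
    have hp : w ^ (i + 1 + 1) = w * w ^ (i + 1) := pow_succ' _ _
    have h1 : |N (i + 1) - w * N i| ≤ w := by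
      rw [abs_le]
      simp only [hN]
      constructor <;> nlinarith
    have hi : (0 : ℝ) ≤ i := Nat.cast_nonneg i
    have h2 : ℓ (i + 1) - w * ℓ i = lam * (N (i + 1) - w * N i) + (1 - w) * e +
        ((i + 1) - w * i) * (mu - lam) := by
      rw [hform, hform]
      push_cast
      ring
    have h3 : |((i : ℝ) + 1) - w * i| ≤ (1 + w) * (i + 1) := by
      rw [abs_le]
      constructor <;> nlinarith
    have h4 : |1 - w| ≤ 1 + w := by rw [abs_le]; constructor <;> linarith
    rw [h2]
    calc _ ≤ |lam * (N (i + 1) - w * N i)| + |(1 - w) * e| +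
          |((i + 1) - w * i) * (mu - lam)| := abs_add_three _ _ _
      _ = lam * |N (i + 1) - w * N i| + |1 - w| * |e| +
          |((i : ℝ) + 1) - w * i| * |mu - lam| := by
            rw [abs_mul, abs_mul, abs_mul, abs_of_nonneg hlam]
      _ ≤ lam * w + (1 + w) * |e| + (1 + w) * (i + 1) * |mu - lam| := by gcongr
      _ ≤ K * (i + 1) := by
        have : 0 ≤ (lam * w + (1 + w) * |e|) * i := by positivity
        rw [hK]
        linarith
  refine ⟨K ^ 2 / (2 * δ) * 4, fun i => (hlin i).trans ?_⟩
  have h5 := hlow i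
  -- Completing the square: K (i + 1) ≤ (δ / 2)(i + 1)² + K² / (2δ).
  have h6 : 0 ≤ δ / 2 * (((i : ℝ) + 1) - K / δ) ^ 2 := by positivity
  have h7 : δ / 2 * (((i : ℝ) + 1) - K / δ) ^ 2 =
      δ / 2 * ((i : ℝ) + 1) ^ 2 - K * (i + 1) + K ^ 2 / (2 * δ) := by
    field_simp
    ring
  have h8 : 0 ≤ K ^ 2 / (2 * δ) := by positivity
  nlinarith

variable {F : Type*} [Field F] [Finite F] {w : ℝ} {b c : F[X]}

theorem polyAbs_cfDen_add {a : ℕ → F[X]} (ha : ∀ n, 1 ≤ (a (n + 1)).natDegree) {n d : ℕ}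
    (h : ∀ j, n ≤ j → j < n + d → a (j + 1) = b) :
    polyAbs (cfDen a (n + d)) = polyAbs b ^ d * polyAbs (cfDen a n) := by
  induction d with
  | zero => simp
  | succ d ih =>
    rw [← add_assoc, polyAbs_cfDen_succ ha, h _ (by omega) (by omega),
      ih fun j h1 h2 => h j h1 (by omega), pow_succ]
    ring

theorem exists_approxSystem (hw : 4 < w) (hbc : b ≠ c) (hb : 1 ≤ b.natDegree)
    (hc : 1 ≤ c.natDegree) :
    ∃ (ξ : LaurentSeries F) (M : ℝ) (k : ℕ → ℕ) (H : ℕ → ℝ),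
      HasContFrac (partialQuot w b c) ξ ∧ ApproxSystem b (partialQuot w b c) ξ M k H ∧
      (∀ i : ℕ, (i : ℝ) ≤ Real.log (H i)) ∧
      ∀ δ > 0, ∃ K, ∀ i, |Real.log (H (i + 1)) - w * Real.log (H i)| ≤ δ * Real.log (H i) + K := by
  set a : ℕ → F[X] := partialQuot w b c with ha_def
  have ha : ∀ n, 1 ≤ (a (n + 1)).natDegree := partialQuot_degree hb hc
  have ha0 : a 0 = 0 := partialQuot_zero
  obtain ⟨ξ, hconv, hξ1, hξ⟩ := exists_hasContFrac ha ha0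
  -- The exponents start at 1, so `N i` ≥ 4 and the subtractions `N i - 1` and `N i - 2` do not
  -- truncate.
  set N : ℕ → ℕ := fun i => ⌊w ^ (i + 1)⌋₊ with hN
  have hN4 : ∀ i, 4 ≤ N i := four_le_floor_pow hw
  have hNs : ∀ i, N i < N (i + 1) := floor_pow_lt_succ hw
  have haN : ∀ i, a (N i) = c := partialQuot_floor hw
  have hab : ∀ i n, N i < n → n < N (i + 1) → a n = b := fun i n =>
    partialQuot_of_lt_of_lt hw
  set q : ℕ → ℝ := fun i => polyAbs (cfDen a (N i)) with hq
  have hqpos : ∀ i, 0 < q i := fun i => polyAbs_cfDen_pos ha _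
  have hqpow : ∀ i, 2 ^ N i ≤ q i := fun i => two_pow_le_polyAbs_cfDen ha _
  have hb1 := one_lt_polyAbs hb
  have hc1 := one_lt_polyAbs hc
  have hbc1 := one_le_polyAbs (sub_ne_zero.mpr hbc)
  have hstep : ∀ i, q (i + 1) = polyAbs c * (polyAbs b ^ (N (i + 1) - N i - 1) * q i) := by
    intro i
    have h1 := hNs i
    have h2 : N (i + 1) = N i + (N (i + 1) - N i - 1) + 1 := by omega
    have h3 : a (N i + (N (i + 1) - N i - 1) + 1) = c := by rw [← h2, haN]
    simp only [hq]
    rw [← polyAbs_cfDen_add ha (fun j h3 h4 => hab i (j + 1) (by omega) (by omega))]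
    conv_lhs => rw [h2]
    rw [polyAbs_cfDen_succ ha, h3]
  have hq1 : ∀ i, 1 ≤ q i := fun i => (one_le_pow₀ one_le_two).trans (hqpow i)
  have hqmono : ∀ i, q i ≤ q (i + 1) := by
    intro i
    rw [hstep, ← mul_assoc]
    refine le_mul_of_one_le_left (hqpos i).le ?_
    exact one_le_mul_of_one_le_of_one_le hc1.le (one_le_pow₀ hb1.le)
  have hlow : ∀ i : ℕ, ((i : ℝ) + 1) ^ 2 ≤ 2 * Real.log (q i) := by
    intro i
    have h1 := Real.log_le_log (by positivity) (hqpow i)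
    rw [Real.log_pow] at h1
    have h2 := sq_le_floor_pow hw i
    have h3 := Real.log_two_gt_d9
    have h4 : ((N i : ℕ) : ℝ) = (⌊w ^ (i + 1)⌋₊ : ℝ) := rfl
    nlinarith
  have hrec : ∀ i, Real.log (q (i + 1)) = Real.log (q i) +
      ((⌊w ^ (i + 1 + 1)⌋₊ : ℝ) - ⌊w ^ (i + 1)⌋₊ - 1) * Real.log (polyAbs b) +
      Real.log (polyAbs c) := by
    intro i
    have h1 := hNs i
    have hbpos : (0 : ℝ) < polyAbs b := by linarith
    rw [hstep, Real.log_mul (by linarith) (by have := hqpos i; positivity),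
      Real.log_mul (by positivity) (hqpos i).ne', Real.log_pow, Nat.cast_sub (by omega),
      Nat.cast_sub h1.le]
    simp only [hN]
    push_cast
    ring
  -- All partial quotients strictly between `N i` and `N (i + 1)` are b, so the index may be moved
  -- from `N i - 1` to `N (i + 1) - 2`, just before the next c.
  have hval : ∀ i, laurentAbs F ((quadPoly b a (N i - 1)).eval₂ (polyToLaurent F) ξ) =
      polyAbs (b - c) * polyAbs c / q (i + 1) ^ 2 := by
    intro i
    have h1 := hNs i
    have h4 := hN4 i
    have h2 : N i - 1 + (N (i + 1) - N i - 1) + 2 = N (i + 1) := by omega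
    have h3 := laurentAbs_eval_quadPoly ha hbc hξ (k := N i - 1 + (N (i + 1) - N i - 1))
      (by rw [h2, haN])
    rw [h2] at h3
    rw [← h3]
    rcases quadPoly_add (b := b) (a := a) (N i - 1) (N (i + 1) - N i - 1)
      (fun j h5 h6 => hab i (j + 2) (by omega) (by omega)) with h | h
    · rw [h]
    · rw [h, eval₂_neg, (laurentAbs F).map_neg]
  have hcoeff : ∀ i j, polyAbs ((quadPoly b a (N i - 1)).coeff j) ≤ polyAbs b * q i ^ 2 := by
    intro i j
    have h4 := hN4 i
    have := polyAbs_quadPoly_coeff_le ha ha0 hb (N i - 1) j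
    rwa [show N i - 1 + 1 = N i by omega] at this
  set M := polyAbs b * (polyAbs (b - c) * polyAbs c) with hM
  have hbc2 : 1 ≤ polyAbs (b - c) * polyAbs c := one_le_mul_of_one_le_of_one_le hbc1 hc1.le
  have hbM : polyAbs b ≤ M := le_mul_of_one_le_right (polyAbs_nonneg _) hbc2
  have hM2 : polyAbs (b - c) * polyAbs c ≤ M := le_mul_of_one_le_left (by positivity) hb1.le
  have hM1 : 1 ≤ M := hb1.le.trans hbM
  refine ⟨ξ, M, fun i => N i - 1, fun i => q i ^ 2, hconv, ?_, ?_, ?_⟩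
  · refine ⟨hM1, hb, hξ1.le, fun i => one_le_pow₀ (hq1 i), fun i j => ?_, fun i => ?_, fun i => ?_,
      fun i => ?_, fun i => ?_⟩
    · exact (hcoeff i j).trans (by gcongr)
    · have h4 := hN4 i
      have h1 := polyAbs_quadPoly_lead ha hbc (k := N i - 2)
        (by rw [show N i - 2 + 2 = N i by omega, haN])
      rw [show N i - 2 + 2 = N i by omega, show N i - 2 + 1 = N i - 1 by omega] at h1
      have h2 := polyAbs_cfDen_succ ha (N i - 1)
      rw [show N i - 1 + 1 = N i by omega, haN] at h2
      have h3 := polyAbs_cfDen_pos ha (N i - 1)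
      rw [h1, sq]
      change q i = _ at h2
      change q i * q i ≤ M * (polyAbs (b - c) * (polyAbs (cfDen a (N i - 1)) * q i))
      have h5 : polyAbs c ≤ M * polyAbs (b - c) := by
        have h6 : polyAbs c ≤ M := (le_mul_of_one_le_left (by linarith) hbc1).trans hM2
        exact h6.trans (le_mul_of_one_le_right (by linarith) hbc1)
      calc q i * q i = polyAbs c * (polyAbs (cfDen a (N i - 1)) * q i) := by
            nth_rw 1 [h2]; ring
        _ ≤ M * polyAbs (b - c) * (polyAbs (cfDen a (N i - 1)) * q i) := by
          have := hqpos i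
          gcongr
        _ = _ := by ring
    · rw [hval]
      gcongr
    · rw [hval]
      have := hqpos (i + 1)
      calc _ ≤ 1 / q (i + 1) ^ 2 := by
            gcongr
            exact le_mul_of_one_le_left (by positivity) hM1
        _ ≤ _ := by gcongr
    · have hdisc := quadPoly_discrim b a (N i - 1)
      have h2 := eval₂_quadratic (polyToLaurent F) (quadPoly_natDegree_le b a (N i - 1)) ξ
      have h3 := hval i
      have hA := hcoeff i 2
      set Q := quadPoly b a (N i - 1)
      -- The identity Q'(ξ)² = disc Q + 4 A Q(ξ), with A the leading coefficient; the last term is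
      -- bounded because |A| ≪ H_i ≤ H_{i+1} and |Q(ξ)| ≪ 1 / H_{i+1}.
      have hsq : (2 * polyToLaurent F (Q.coeff 2) * ξ + polyToLaurent F (Q.coeff 1)) ^ 2 =
          polyToLaurent F (b ^ 2 + 4) +
            polyToLaurent F (4 * Q.coeff 2) * Q.eval₂ (polyToLaurent F) ξ := by
        rw [← hdisc, h2]
        simp only [map_sub, map_mul, map_pow, map_ofNat]
        ring
      have h4 : polyAbs (4 : F[X]) ≤ 1 := polyAbs_ofNat_le 4
      have hA0 := polyAbs_nonneg (Q.coeff 2)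
      have hqi := hqpos i
      have hqi1 := hqpos (i + 1)
      have hle : laurentAbs F
          ((2 * polyToLaurent F (Q.coeff 2) * ξ + polyToLaurent F (Q.coeff 1)) ^ 2) ≤ M ^ 2 := by
        rw [hsq]
        refine laurentAbs_add_le ?_ ?_
        · refine polyAbs_add_le (P := b ^ 2) (Q := 4) ?_ (h4.trans (one_le_pow₀ hM1))
          rw [sq, polyAbs_mul, sq]
          exact mul_le_mul hbM hbM (polyAbs_nonneg _) (by linarith)
        · rw [map_mul, h3]
          change polyAbs (4 * Q.coeff 2) * _ ≤ _
          rw [polyAbs_mul]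
          calc _ ≤ 1 * (polyAbs b * q i ^ 2) * (polyAbs (b - c) * polyAbs c / q (i + 1) ^ 2) := by
                gcongr
            _ ≤ 1 * (polyAbs b * q (i + 1) ^ 2) *
                (polyAbs (b - c) * polyAbs c / q (i + 1) ^ 2) := by
                gcongr
                exact hqmono i
            _ = M := by rw [hM]; field_simp
            _ ≤ M ^ 2 := le_self_pow₀ hM1 two_ne_zero
      rw [map_pow] at hle
      exact le_of_sq_le_sq hle (by linarith)
  · intro i
    rw [Real.log_pow]
    have := hlow i
    push_cast
    have hi : (0 : ℝ) ≤ i := Nat.cast_nonneg i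
    nlinarith
  · intro δ hδ
    obtain ⟨K, hK⟩ := exists_abs_sub_le hw (Real.log_nonneg hb1.le) hrec hlow hδ
    refine ⟨2 * K, fun i => ?_⟩
    rw [Real.log_pow, Real.log_pow]
    push_cast
    rw [show 2 * Real.log (q (i + 1)) - w * (2 * Real.log (q i)) =
      2 * (Real.log (q (i + 1)) - w * Real.log (q i)) by ring, abs_mul, abs_two]
    linarith [hK i]

end SparseSequence

/-! ### The absolute value on the algebraic closure -/

section AlgAbs

variable {F : Type*} [Field F] [Finite F]

theorem algAbs_mul_le (x y : AlgebraicClosure (LaurentSeries F)) :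
    algAbs F (x * y) ≤ algAbs F x * algAbs F y := by
  let _ : NormedField (LaurentSeries F) := (laurentAbs F).toNormedField
  have : IsUltrametricDist (LaurentSeries F) :=
    IsUltrametricDist.isUltrametricDist_of_forall_norm_add_le_max_norm laurentAbs_add_le_max
  exact spectralNorm_mul (K := LaurentSeries F) (Algebra.IsAlgebraic.isAlgebraic x)
    (Algebra.IsAlgebraic.isAlgebraic y)

theorem algAbs_nonneg (x : AlgebraicClosure (LaurentSeries F)) : 0 ≤ algAbs F x := by
  let _ : NormedField (LaurentSeries F) := (laurentAbs F).toNormedField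
  exact spectralNorm_nonneg (K := LaurentSeries F) x

theorem algAbs_sub_le_max (x y : AlgebraicClosure (LaurentSeries F)) :
    algAbs F (x - y) ≤ max (algAbs F x) (algAbs F y) := by
  let _ : NormedField (LaurentSeries F) := (laurentAbs F).toNormedField
  have : IsUltrametricDist (LaurentSeries F) :=
    IsUltrametricDist.isUltrametricDist_of_forall_norm_add_le_max_norm laurentAbs_add_le_max
  have h1 := isNonarchimedean_spectralNorm (K := LaurentSeries F)
    (L := AlgebraicClosure (LaurentSeries F)) x (-y)
  rw [spectralNorm_neg (Algebra.IsAlgebraic.isAlgebraic y), ← sub_eq_add_neg] at h1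
  exact h1

/-- The value of a quadratic polynomial at `ξ` in terms of the distance of `ξ` to a root. -/
theorem laurentAbs_eval_le_of_root {P : F[X][X]} (hP : P.natDegree ≤ 2) (ξ : LaurentSeries F)
    {α : AlgebraicClosure (LaurentSeries F)} (hα : P.eval₂ (polyToAlg F) α = 0) {t h d : ℝ}
    (ht : algAbs F (algebraMap _ _ ξ - α) ≤ t) (hh : polyAbs (P.coeff 2) ≤ h)
    (hd : laurentAbs F (2 * polyToLaurent F (P.coeff 2) * ξ + polyToLaurent F (P.coeff 1)) ≤ d) :
    laurentAbs F (P.eval₂ (polyToLaurent F) ξ) ≤ t * max d (h * t) := by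
  have ht0 := (algAbs_nonneg _).trans ht
  have hh0 := (polyAbs_nonneg _).trans hh
  have hpa : ∀ Q : F[X], polyToAlg F Q =
      algebraMap (LaurentSeries F) (AlgebraicClosure (LaurentSeries F)) (polyToLaurent F Q) :=
    fun Q => rfl
  rw [eval₂_quadratic _ hP] at hα ⊢
  simp only [hpa] at hα
  set ι := algebraMap (LaurentSeries F) (AlgebraicClosure (LaurentSeries F)) with hι
  rw [← algAbs_algebraMap, ← hι]
  -- Taylor expansion at ξ, using P(α) = 0.
  have e : ι (polyToLaurent F (P.coeff 2) * ξ ^ 2 + polyToLaurent F (P.coeff 1) * ξ +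
      polyToLaurent F (P.coeff 0)) = (ι ξ - α) *
      (ι (2 * polyToLaurent F (P.coeff 2) * ξ + polyToLaurent F (P.coeff 1)) -
        ι (polyToLaurent F (P.coeff 2)) * (ι ξ - α)) := by
    simp only [map_add, map_mul, map_pow, map_ofNat]
    linear_combination hα
  rw [e]
  refine (algAbs_mul_le _ _).trans (mul_le_mul ht ?_ (algAbs_nonneg _) ht0)
  refine (algAbs_sub_le_max _ _).trans (max_le_max ?_ ?_)
  · rwa [hι, algAbs_algebraMap]
  · refine (algAbs_mul_le _ _).trans (mul_le_mul ?_ ht (algAbs_nonneg _) hh0)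
    rwa [hι, algAbs_algebraMap]

end AlgAbs

/-! ### Upper exponents from polynomial bounds -/

section Exponents

theorem tendsto_log_natCast : Tendsto (fun n : ℕ => Real.log n) atTop atTop :=
  Real.tendsto_log_atTop.comp tendsto_natCast_atTop_atTop

theorem limsup_div_log_eq {g : ℕ → ℝ} {v : ℝ}
    (hupper : ∀ δ > 0, ∃ K, ∀ n : ℕ, 1 ≤ n → g n ≤ (v + δ) * Real.log n + K)
    (hlower : ∀ δ > 0, ∃ K, ∃ m : ℕ → ℕ, Tendsto m atTop atTop ∧
      ∀ᶠ i in atTop, (v - δ) * Real.log (m i) - K ≤ g (m i)) :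
    limsup (fun n : ℕ => ((g n / Real.log n : ℝ) : EReal)) atTop = (v : EReal) := by
  apply le_antisymm
  · refine (EReal.le_of_forall_lt_iff_le).mp fun z hz => ?_
    have hz' : v < z := by exact_mod_cast hz
    obtain ⟨K, hK⟩ := hupper ((z - v) / 2) (by linarith)
    refine limsup_le_of_le (by isBoundedDefault) ?_
    filter_upwards [tendsto_log_natCast.eventually_ge_atTop (max 1 (K / ((z - v) / 2))),
      eventually_ge_atTop 1] with n hn hn1
    have h1 : 1 ≤ Real.log n := (le_max_left _ _).trans hn
    have h2 : K ≤ (z - v) / 2 * Real.log n := by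
      have := (le_max_right _ _).trans hn
      rwa [div_le_iff₀' (by linarith)] at this
    have h3 := hK n hn1
    rw [EReal.coe_le_coe_iff, div_le_iff₀ (by linarith)]
    linarith
  · refine (EReal.ge_of_forall_gt_iff_ge).mp fun z hz => ?_
    have hz' : z < v := by exact_mod_cast hz
    obtain ⟨K, m, hm, hK⟩ := hlower ((v - z) / 2) (by linarith)
    refine le_limsup_of_frequently_le (hm.frequently (Eventually.frequently ?_))
      (by isBoundedDefault)
    filter_upwards [hK, (tendsto_log_natCast.comp hm).eventually_ge_atTop
      (max 1 (K / ((v - z) / 2)))] with i h3 hn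
    have h1 : 1 ≤ Real.log (m i) := (le_max_left _ _).trans hn
    have h2 : K ≤ (v - z) / 2 * Real.log (m i) := by
      have := (le_max_right _ _).trans hn
      rwa [div_le_iff₀' (by linarith)] at this
    rw [EReal.coe_le_coe_iff, le_div_iff₀ (by linarith)]
    linarith

/-- Take the least i with the first inequality. Its failure at i - 1, together with ℓ i ≥ v ℓ (i -
1) - |K₀| for some v < w close to w, gives (v - 1) ℓ i ≤ 2vη + O(1), and 2v / (v - 1) ≤ w - 2. -/
theorem exists_index {ℓ : ℕ → ℝ} {w c : ℝ} (hw : 4 < w) (hw2 : 0 < w ^ 2 - 5 * w + 2) (hc : 0 ≤ c)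
    (hlow : ∀ i : ℕ, (i : ℝ) ≤ ℓ i)
    (hgrow : ∀ δ > 0, ∃ K, ∀ i, |ℓ (i + 1) - w * ℓ i| ≤ δ * ℓ i + K) :
    ∃ K, 0 ≤ K ∧ ∀ η, 0 ≤ η → ∃ i, c + 2 * η + ℓ i < ℓ (i + 1) ∧ ℓ i ≤ (w - 2) * η + K := by
  have hw0 : 0 < w := by linarith
  -- With this δ and v = w - δ one has (w - 2)(v - 1) - 2v = 4δ, and still v > 4.
  obtain ⟨δ, hδ⟩ : ∃ δ, δ = (w ^ 2 - 5 * w + 2) / w := ⟨_, rfl⟩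
  have hδw : δ * w = w ^ 2 - 5 * w + 2 := by rw [hδ]; field_simp
  have hδ0 : 0 < δ := by rw [hδ]; positivity
  obtain ⟨K₀, hK₀⟩ := hgrow δ hδ0
  obtain ⟨v, hv⟩ : ∃ v, v = w - δ := ⟨_, rfl⟩
  have hv4 : 4 < v := by
    have : δ * w < (w - 4) * w := by nlinarith
    have := lt_of_mul_lt_mul_right this hw0.le
    linarith
  have hv2 : 2 * v ≤ (w - 2) * (v - 1) := by rw [hv]; nlinarith
  have hstep : ∀ i, v * ℓ i ≤ ℓ (i + 1) + |K₀| := by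
    intro i
    have h1 := (abs_le.mp (hK₀ i)).1
    have h2 := le_abs_self K₀
    rw [hv]
    linarith
  have hl0 : ∀ i, 0 ≤ ℓ i := fun i => (Nat.cast_nonneg i).trans (hlow i)
  have hK0 := abs_nonneg K₀
  have h00 := hl0 0
  refine ⟨ℓ 0 + v * c + |K₀|, by positivity, fun η hη => ?_⟩
  have hex : ∃ i, c + 2 * η + ℓ i < ℓ (i + 1) := by
    obtain ⟨i, hi⟩ := exists_nat_gt (c + 2 * η + |K₀|)
    refine ⟨i, ?_⟩
    have h1 := hstep i
    have h2 := hlow i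
    nlinarith
  refine ⟨Nat.find hex, Nat.find_spec hex, ?_⟩
  rcases Nat.eq_zero_or_eq_succ_pred (Nat.find hex) with h0 | h0
  · rw [h0]
    have h3 : 0 ≤ (w - 2) * η := mul_nonneg (by linarith) hη
    have h4 : 0 ≤ v * c := by positivity
    linarith
  · have hmin := Nat.find_min hex (m := (Nat.find hex).pred) (by omega)
    rw [h0]
    set j := (Nat.find hex).pred
    rw [not_lt] at hmin
    have h1 := hstep j
    change ℓ (j + 1) ≤ _
    have h2 : (v - 1) * ℓ (j + 1) ≤ 2 * v * η + v * c + |K₀| := by nlinarith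
    have h3 : 2 * v * η ≤ (w - 2) * (v - 1) * η := mul_le_mul_of_nonneg_right hv2 hη
    have h4 : 0 ≤ v * c := by positivity
    have h5 : (v - 1) * ℓ (j + 1) ≤ (v - 1) * ((w - 2) * η + (ℓ 0 + v * c + |K₀|)) := by nlinarith
    exact le_of_mul_le_mul_left h5 (by linarith)

theorem neg_log_mul_sInf_le {s : Set ℝ} {c κ : ℝ} (hc : 0 < c) (hκ : 0 ≤ κ)
    (h : ∀ r ∈ s, Real.exp (-κ) ≤ c * r) : -Real.log (c * sInf s) ≤ κ := by
  rcases s.eq_empty_or_nonempty with rfl | hs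
  -- For the empty set `sInf` and its logarithm are 0, whence the hypothesis 0 ≤ κ.
  · simpa using hκ
  · have h1 : Real.exp (-κ) / c ≤ sInf s :=
      le_csInf hs fun r hr => (div_le_iff₀' hc).mpr (h r hr)
    have h2 := Real.log_le_log (Real.exp_pos _) ((div_le_iff₀' hc).mp h1)
    rw [Real.log_exp] at h2
    linarith

/-- The bound ε keeps the infimum positive; the convention log 0 = 0 would otherwise break
monotonicity. -/
theorem log_mul_sInf_le {s : Set ℝ} {c r ε : ℝ} (hc : 0 < c) (hε : 0 < ε) (h : ∀ x ∈ s, ε ≤ x)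
    (hr : r ∈ s) : Real.log (c * sInf s) ≤ Real.log (c * r) := by
  have h1 : 0 < sInf s := hε.trans_le (le_csInf ⟨r, hr⟩ h)
  exact Real.log_le_log (by positivity) (mul_le_mul_of_nonneg_left (csInf_le ⟨ε, h⟩ hr) hc.le)

end Exponents

/-! ### Exponents of an approximation system -/

namespace ApproxSystem

variable {F : Type*} [Field F] [Finite F] {a : ℕ → F[X]} {b : F[X]} {ξ : LaurentSeries F} {M : ℝ}
  {k : ℕ → ℕ} {H : ℕ → ℝ} {w : ℝ}

/-- The exponent is w - 1 = 1 + (w - 2): `liouville` gives 1 / (h H_i) and `exists_index` bounds H_i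
by h^{w-2}, up to constants. Being w - 1 and not w, it leaves a factor h to spare for distances to
roots. -/
theorem exists_value_bound (S : ApproxSystem b a ξ M k H) (hw : 4 < w)
    (hw2 : 0 < w ^ 2 - 5 * w + 2) (hlow : ∀ i : ℕ, (i : ℝ) ≤ Real.log (H i))
    (hgrow : ∀ δ > 0, ∃ K, ∀ i,
      |Real.log (H (i + 1)) - w * Real.log (H i)| ≤ δ * Real.log (H i) + K) :
    ∃ K, 0 ≤ K ∧ ∀ P : F[X][X], P ≠ 0 → P.natDegree ≤ 2 → ∀ h : ℝ, 1 ≤ h → height P ≤ h →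
      Real.exp (-((w - 1) * Real.log h + K)) ≤ laurentAbs F (P.eval₂ (polyToLaurent F) ξ) ∨
      ∃ (i : ℕ) (d : F[X]), d ≠ 0 ∧ P = C d * quadPoly b a (k i) ∧
        Real.log (H i) ≤ Real.log h + K := by
  have hM := S.one_le_const
  have hLM := Real.log_nonneg hM
  obtain ⟨K, hK0, hK⟩ := exists_index hw hw2 (c := 2 * Real.log M) (by positivity) hlow hgrow
  refine ⟨K + 2 * Real.log M, by positivity, fun P hP0 hP h hh hPh => ?_⟩
  obtain ⟨i, hi1, hi2⟩ := hK (Real.log h) (Real.log_nonneg hh)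
  have hH := S.one_le i
  have hH' := S.one_le (i + 1)
  have hi : M ^ 2 * h ^ 2 * H i < H (i + 1) := by
    rw [← Real.log_lt_log_iff (by positivity) (by positivity),
      Real.log_mul (by positivity) (by positivity), Real.log_mul (by positivity) (by positivity),
      Real.log_pow, Real.log_pow]
    push_cast
    exact hi1
  rcases S.liouville hP hh hPh hi with ⟨d, hd⟩ | hle
  · have hd0 : d ≠ 0 := by
      rintro rfl
      exact hP0 (by rw [hd]; simp)
    refine Or.inr ⟨i, d, hd0, hd, ?_⟩
    have h1 := height_C_mul_quadPoly_leading (b := b) (a := a) (k := k i) d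
    rw [← hd] at h1
    have h2 := one_le_polyAbs hd0
    have h3 : polyAbs ((quadPoly b a (k i)).coeff 2) ≤ h :=
      (le_mul_of_one_le_left (polyAbs_nonneg _) h2).trans (h1.trans hPh)
    have h4 : H i ≤ M * h := (S.le_lead i).trans (by gcongr)
    have h5 := Real.log_le_log (by positivity) h4
    rw [Real.log_mul (by positivity) (by positivity)] at h5
    linarith
  · refine Or.inl (le_trans ?_ hle)
    rw [← Real.le_log_iff_exp_le (by positivity), one_div, Real.log_inv,
      Real.log_mul (by positivity) (by positivity), Real.log_mul (by positivity) (by positivity),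
      Real.log_pow]
    push_cast
    linarith

theorem exists_quadPoly_bound (S : ApproxSystem b a ξ M k H)
    (hgrow : ∀ δ > 0, ∃ K, ∀ i,
      |Real.log (H (i + 1)) - w * Real.log (H i)| ≤ δ * Real.log (H i) + K) {δ : ℝ} (hδ : 0 < δ) :
    ∃ K, 0 ≤ K ∧ ∀ i, Real.exp (-((w + δ) * Real.log (H i) + K)) ≤
      laurentAbs F ((quadPoly b a (k i)).eval₂ (polyToLaurent F) ξ) := by
  have hM := S.one_le_const
  have hLM := Real.log_nonneg hM
  obtain ⟨K, hK⟩ := hgrow δ hδ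
  refine ⟨|K| + Real.log M, by positivity, fun i => le_trans ?_ (S.le_eval i)⟩
  have hH := S.one_le (i + 1)
  rw [← Real.le_log_iff_exp_le (by positivity), one_div, Real.log_inv,
    Real.log_mul (by positivity) (by positivity)]
  have h1 := (abs_le.mp (hK i)).2
  have h2 := le_abs_self K
  linarith

theorem exists_mahler_lower (S : ApproxSystem b a ξ M k H) (hw : 4 < w)
    (hw2 : 0 < w ^ 2 - 5 * w + 2) (hlow : ∀ i : ℕ, (i : ℝ) ≤ Real.log (H i))
    (hgrow : ∀ δ > 0, ∃ K, ∀ i,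
      |Real.log (H (i + 1)) - w * Real.log (H i)| ≤ δ * Real.log (H i) + K) {δ : ℝ} (hδ : 0 < δ) :
    ∃ K, 0 ≤ K ∧ ∀ P : F[X][X], P ≠ 0 → P.natDegree ≤ 2 → ∀ h : ℝ, 1 ≤ h → height P ≤ h →
      Real.exp (-((w + δ) * Real.log h + K)) ≤ laurentAbs F (P.eval₂ (polyToLaurent F) ξ) := by
  obtain ⟨K₁, hK₁, hv⟩ := S.exists_value_bound hw hw2 hlow hgrow
  obtain ⟨K₂, hK₂, hq⟩ := S.exists_quadPoly_bound hgrow hδ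
  refine ⟨K₂ + (w + δ) * K₁ + K₁, by positivity, fun P hP0 hP h hh hPh => ?_⟩
  have hlog := Real.log_nonneg hh
  have hwK : 0 ≤ (w + δ) * K₁ := by positivity
  rcases hv P hP0 hP h hh hPh with h1 | ⟨i, d, hd0, rfl, hi⟩
  · refine le_trans (Real.exp_le_exp.mpr ?_) h1
    nlinarith
  · rw [eval₂_mul, eval₂_C, map_mul]
    refine le_trans (Real.exp_le_exp.mpr ?_) ((hq i).trans
      (le_mul_of_one_le_left ((laurentAbs F).nonneg _) (one_le_polyAbs hd0)))
    have := mul_le_mul_of_nonneg_left hi (show 0 ≤ w + δ by linarith)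
    linarith

theorem exists_koksma_lower (S : ApproxSystem b a ξ M k H) (hw : 4 < w)
    (hw2 : 0 < w ^ 2 - 5 * w + 2) (hlow : ∀ i : ℕ, (i : ℝ) ≤ Real.log (H i))
    (hgrow : ∀ δ > 0, ∃ K, ∀ i,
      |Real.log (H (i + 1)) - w * Real.log (H i)| ≤ δ * Real.log (H i) + K) {δ : ℝ} (hδ : 0 < δ) :
    ∃ K, 0 ≤ K ∧ ∀ (α : AlgebraicClosure (LaurentSeries F)) (P : F[X][X]), IsMinPoly P α →
      P.natDegree ≤ 2 → ∀ h : ℝ, 1 ≤ h → height P ≤ h →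
      Real.exp (-((w + δ) * Real.log h + K)) ≤ algAbs F (algebraMap _ _ ξ - α) := by
  obtain ⟨K₁, hK₁, hv⟩ := S.exists_value_bound hw hw2 hlow hgrow
  obtain ⟨K₂, hK₂, hq⟩ := S.exists_quadPoly_bound hgrow hδ
  have hM := S.one_le_const
  have hLM := Real.log_nonneg hM
  refine ⟨K₂ + (w + δ) * K₁ + K₁ + Real.log M, by positivity, fun α P hPα hP h hh hPh => ?_⟩
  have hlog := Real.log_nonneg hh
  have hwK : 0 ≤ (w + δ) * K₁ := by positivity
  obtain ⟨-, hirr, -, -, hroot⟩ := hPα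
  by_contra! hlt
  set t := algAbs F (algebraMap _ _ ξ - α) with ht
  have ht0 : 0 ≤ t := algAbs_nonneg _
  have hwlog : 0 ≤ (w + δ) * Real.log h := by positivity
  rcases hv P hirr.ne_zero hP h hh hPh with h1 | ⟨i, d, hd0, hd, hi⟩
  -- Here |P(ξ)| ≤ h |ξ - α|; the factor h turns the exponent w - 1 into w.
  · have hPc : ∀ j, polyAbs (P.coeff j) ≤ h := fun j => (polyAbs_coeff_le_height P j).trans hPh
    have h2 := laurentAbs_eval_le_of_root hP ξ hroot le_rfl (hPc 2)
      (laurentAbs_deriv_le S.abs_le_one (hPc 2) (hPc 1))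
    rw [← ht] at h2
    have ht1 : t ≤ 1 := hlt.le.trans (Real.exp_le_one_iff.mpr (by linarith))
    have h3 : max h (h * t) = h := max_eq_left (mul_le_of_le_one_right (by linarith) ht1)
    rw [h3] at h2
    have h4 : t * h < Real.exp (-((w - 1) * Real.log h + K₁)) := by
      calc t * h < Real.exp (-((w + δ) * Real.log h + (K₂ + (w + δ) * K₁ + K₁ + Real.log M))) * h :=
            mul_lt_mul_of_pos_right hlt (by linarith)
        _ = Real.exp (-((w + δ) * Real.log h + (K₂ + (w + δ) * K₁ + K₁ + Real.log M)) +
            Real.log h) := by rw [Real.exp_add, Real.exp_log (by linarith)]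
        _ ≤ _ := Real.exp_le_exp.mpr (by nlinarith)
    linarith
  · have hHi := S.one_le i
    have hℓ := Real.log_nonneg hHi
    have hQroot : (quadPoly b a (k i)).eval₂ (polyToAlg F) α = 0 := by
      rw [hd, eval₂_mul, eval₂_C] at hroot
      refine (mul_eq_zero.mp hroot).resolve_left ?_
      rw [polyToAlg, RingHom.comp_apply]
      exact (_root_.map_ne_zero _).mpr ((map_ne_zero_iff _ polyToLaurent_injective).mpr hd0)
    have h2 := laurentAbs_eval_le_of_root (quadPoly_natDegree_le b a (k i)) ξ hQroot le_rfl
      (S.coeff_le i 2) (S.deriv_le i)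
    rw [← ht] at h2
    set Z := (w + δ) * Real.log (H i) + K₂ + Real.log M with hZ
    have htZ : t < Real.exp (-Z) := by
      refine hlt.trans_le (Real.exp_le_exp.mpr ?_)
      have := mul_le_mul_of_nonneg_left hi (show 0 ≤ w + δ by linarith)
      linarith
    have hexp : Real.exp (-((w + δ) * Real.log (H i) + K₂)) = Real.exp (-Z) * M := by
      rw [show -((w + δ) * Real.log (H i) + K₂) = -Z + Real.log M by rw [hZ]; ring,
        Real.exp_add, Real.exp_log (by linarith)]
    have h3 : Real.exp (-Z) * M ≤ t * max M (M * H i * t) := by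
      rw [← hexp]
      exact (hq i).trans h2
    -- This makes the quadratic Taylor term at most the bound M on the derivative, so that |Q(ξ)| ≤
    -- M |ξ - α| with no loss of a height.
    have h4 : H i * t ≤ 1 := by
      calc H i * t ≤ H i * Real.exp (-Z) := by gcongr
        _ = Real.exp (Real.log (H i) + -Z) := by rw [Real.exp_add, Real.exp_log (by linarith)]
        _ ≤ 1 := Real.exp_le_one_iff.mpr (by nlinarith)
    have h5 : max M (M * H i * t) = M := by
      refine max_eq_left ?_
      rw [mul_assoc]
      exact mul_le_of_le_one_right (by linarith) h4
    rw [h5] at h3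
    exact absurd (le_of_mul_le_mul_right h3 (by linarith)) (not_le.mpr htZ)

/-- A root of `quadPoly b a (k i)` in `F((T⁻¹))` that is very close to `ξ`. -/
theorem exists_close_root (S : ApproxSystem b a ξ M k H) {i : ℕ} (hi : M ^ 2 * H i < H (i + 1)) :
    ∃ α : LaurentSeries F, (quadPoly b a (k i)).eval₂ (polyToLaurent F) α = 0 ∧
      laurentAbs F (ξ - α) ≤ M / H (i + 1) := by
  obtain ⟨β, hβ⟩ := exists_sq_eq_mul_add_one S.degree_pos
  have hM := S.one_le_const
  have hH := S.one_le i
  have hH' := S.one_le (i + 1)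
  have hEv := S.eval_le i
  have hA := S.coeff_le i 2
  have hdisc := quadPoly_discrim b a (k i)
  have hlead := quadPoly_lead_ne_zero S.degree_pos a (k i)
  have hQ2 := quadPoly_natDegree_le b a (k i)
  have heval := eval₂_quadPoly (polyToLaurent F) b a (k i)
  have hlead' := quadPoly_coeff_two b a (k i)
  set Q := quadPoly b a (k i) with hQ
  -- β splits the norm form, so Q has a root in F((T⁻¹)): the solution of q_{k+1} x - p_{k+1} = β
  -- (q_k x - p_k).
  obtain ⟨α, hα⟩ : ∃ α : LaurentSeries F, Q.eval₂ (polyToLaurent F) α = 0 := by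
    set D := polyToLaurent F (cfDen a (k i + 1)) - β * polyToLaurent F (cfDen a (k i)) with hD
    have hD0 : D ≠ 0 := by
      intro h0
      refine hlead (polyToLaurent_injective ?_)
      rw [map_zero, hlead', normForm]
      simp only [map_add, map_sub, map_mul, map_pow]
      have h1 : polyToLaurent F (cfDen a (k i + 1)) = β * polyToLaurent F (cfDen a (k i)) :=
        sub_eq_zero.mp h0
      rw [h1]
      linear_combination -(polyToLaurent F (cfDen a (k i))) ^ 2 * hβ
    refine ⟨(polyToLaurent F (cfNum a (k i + 1)) - β * polyToLaurent F (cfNum a (k i))) / D, ?_⟩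
    set x := (polyToLaurent F (cfNum a (k i + 1)) - β * polyToLaurent F (cfNum a (k i))) / D with hx
    have h2 : x * D = polyToLaurent F (cfNum a (k i + 1)) - β * polyToLaurent F (cfNum a (k i)) :=
      div_mul_cancel₀ _ hD0
    have h3 : polyToLaurent F (cfDen a (k i + 1)) * x - polyToLaurent F (cfNum a (k i + 1)) =
        β * (polyToLaurent F (cfDen a (k i)) * x - polyToLaurent F (cfNum a (k i))) := by
      rw [hD] at h2
      linear_combination h2
    rw [heval, h3, normForm]
    linear_combination
      -(polyToLaurent F (cfDen a (k i)) * x - polyToLaurent F (cfNum a (k i))) ^ 2 * hβ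
  have hA0 : polyToLaurent F (Q.coeff 2) ≠ 0 :=
    (map_ne_zero_iff _ polyToLaurent_injective).mpr hlead
  set A := polyToLaurent F (Q.coeff 2) with hA_def
  set B := polyToLaurent F (Q.coeff 1) with hB_def
  set E := Q.eval₂ (polyToLaurent F) ξ with hE
  set D := 2 * A * ξ + B with hD
  have hEq : E = A * ξ ^ 2 + B * ξ + polyToLaurent F (Q.coeff 0) := eval₂_quadratic _ hQ2 ξ
  rw [eval₂_quadratic _ hQ2, ← hA_def, ← hB_def] at hα
  -- D is the derivative at ξ; D² differs from b² + 4 by a term smaller than 1, so |D|² = |b² + 4| =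
  -- |b|².
  have hD1 : 1 ≤ laurentAbs F D := by
    have hb4 : polyAbs (b ^ 2 + 4) = polyAbs b ^ 2 := by
      have hb1 := one_lt_polyAbs S.degree_pos
      have h4 : polyAbs (4 : F[X]) ≤ 1 := polyAbs_ofNat_le 4
      rw [polyAbs_add_eq_left, sq, polyAbs_mul, sq]
      rw [sq, polyAbs_mul]
      nlinarith
    have hsq : D ^ 2 = polyToLaurent F (b ^ 2 + 4) + polyToLaurent F (4 * Q.coeff 2) * E := by
      rw [← hdisc, hEq]
      simp only [map_sub, map_mul, map_pow, map_ofNat, hD, hA_def, hB_def]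
      ring
    have hsmall : laurentAbs F (polyToLaurent F (4 * Q.coeff 2) * E) < 1 := by
      have h4 : polyAbs (4 : F[X]) ≤ 1 := polyAbs_ofNat_le 4
      rw [map_mul]
      change polyAbs (4 * Q.coeff 2) * _ < _
      rw [polyAbs_mul]
      have := polyAbs_nonneg (Q.coeff 2)
      calc _ ≤ 1 * (M * H i) * (M / H (i + 1)) := by gcongr
        _ = M ^ 2 * H i / H (i + 1) := by ring
        _ < 1 := (div_lt_one (by positivity)).mpr hi
    have hb2 : 1 ≤ polyAbs (b ^ 2 + 4) := by
      rw [hb4]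
      exact one_le_pow₀ (one_lt_polyAbs S.degree_pos).le
    have hDsq : laurentAbs F D ^ 2 = polyAbs (b ^ 2 + 4) := by
      rw [← map_pow, hsq]
      exact laurentAbs_add_eq_left (hsmall.trans_le hb2)
    rw [← hDsq] at hb2
    exact (one_le_sq_iff₀ ((laurentAbs F).nonneg _)).mp hb2
  have hother : ∃ α' : LaurentSeries F, A * (α + α') = -B :=
    ⟨-B / A - α, by field_simp; ring⟩
  obtain ⟨α', hα'⟩ := hother
  have hfac : E = A * (ξ - α) * (ξ - α') := by
    rw [hEq]
    linear_combination hα + (ξ - α) * hα'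
  have hroot' : Q.eval₂ (polyToLaurent F) α' = 0 := by
    rw [eval₂_quadratic _ hQ2, ← hA_def, ← hB_def]
    linear_combination hα + (α' - α) * hα'
  have hsum : D = A * (ξ - α) + A * (ξ - α') := by
    rw [hD]
    linear_combination hα'
  -- Since D = A(ξ - α) + A(ξ - α') with |D| ≥ 1, one summand has absolute value at least 1; the
  -- other root is then within |Q(ξ)| of ξ.
  rcases le_or_gt 1 (laurentAbs F (A * (ξ - α))) with h1 | h1
  · refine ⟨α', hroot', le_trans ?_ hEv⟩
    rw [hfac, map_mul]
    exact le_mul_of_one_le_left ((laurentAbs F).nonneg _) h1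
  · refine ⟨α, by rw [eval₂_quadratic _ hQ2]; exact hα, le_trans ?_ hEv⟩
    have h2 : 1 ≤ laurentAbs F (A * (ξ - α')) := by
      by_contra! h2
      have h3 := laurentAbs_add_le_max (A * (ξ - α)) (A * (ξ - α'))
      rw [← hsum] at h3
      exact absurd (hD1.trans h3) (not_le.mpr (max_lt h1 h2))
    rw [hfac, show A * (ξ - α) * (ξ - α') = A * (ξ - α') * (ξ - α) by ring, map_mul]
    exact le_mul_of_one_le_left ((laurentAbs F).nonneg _) h2

theorem height_quadPoly_le (S : ApproxSystem b a ξ M k H) (i : ℕ) :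
    height (quadPoly b a (k i)) ≤ M * H i :=
  height_le (S.coeff_le i)

theorem height_monicQuadPoly_le (S : ApproxSystem b a ξ M k H) (i : ℕ) :
    height (monicQuadPoly b a (k i)) ≤ M * H i := by
  refine height_le fun j => ?_
  rw [monicQuadPoly, coeff_C_mul, polyAbs_mul]
  refine le_trans (le_of_eq ?_) (S.coeff_le i j)
  have h0 : ((quadPoly b a (k i)).coeff 2).leadingCoeff⁻¹ ≠ 0 :=
    inv_ne_zero (by simpa using quadPoly_lead_ne_zero S.degree_pos a (k i))
  rw [polyAbs_of_ne_zero (C_ne_zero.mpr h0), natDegree_C, pow_zero, one_mul]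

/-- The exponents run over integer heights; passing from H_i to ⌈M H_i⌉ changes the logarithm by a
bounded amount only. -/
theorem log_ceil_bounds (S : ApproxSystem b a ξ M k H) (i : ℕ) :
    Real.log (H i) ≤ Real.log ⌈M * H i⌉₊ ∧
      Real.log ⌈M * H i⌉₊ ≤ Real.log (H i) + Real.log (2 * M) := by
  have hM := S.one_le_const
  have hH := S.one_le i
  have hMH : 1 ≤ M * H i := one_le_mul_of_one_le_of_one_le hM hH
  have h1 : M * H i ≤ ⌈M * H i⌉₊ := Nat.le_ceil _
  have h2 : (⌈M * H i⌉₊ : ℝ) < M * H i + 1 := Nat.ceil_lt_add_one (by linarith)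
  constructor
  · exact Real.log_le_log (by linarith) (by nlinarith)
  · rw [← Real.log_mul (by linarith) (by linarith)]
    exact Real.log_le_log (by linarith) (by linarith)

theorem one_le_ceil (S : ApproxSystem b a ξ M k H) (i : ℕ) : (1 : ℝ) ≤ ⌈M * H i⌉₊ :=
  (one_le_mul_of_one_le_of_one_le S.one_le_const (S.one_le i)).trans (Nat.le_ceil _)

theorem log_value_le (S : ApproxSystem b a ξ M k H) (hw : 4 < w) {δ K : ℝ} (hδ : 0 < δ) {i : ℕ}
    (hK : |Real.log (H (i + 1)) - w * Real.log (H i)| ≤ δ * Real.log (H i) + K) :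
    Real.log (M / H (i + 1)) ≤
      -((w - δ) * Real.log ⌈M * H i⌉₊) + (K + w * Real.log (2 * M) + Real.log M) := by
  have hM := S.one_le_const
  have hH' := S.one_le (i + 1)
  obtain ⟨h1, h2⟩ := S.log_ceil_bounds i
  rw [Real.log_div (by linarith) (by linarith)]
  have h3 := (abs_le.mp hK).1
  have h4 := mul_le_mul_of_nonneg_left h1 hδ.le
  have h5 := mul_le_mul_of_nonneg_left h2 (show 0 ≤ w by linarith)
  linarith

theorem eventually_lt (S : ApproxSystem b a ξ M k H) (hw : 4 < w)
    (hlow : ∀ i : ℕ, (i : ℝ) ≤ Real.log (H i))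
    (hgrow : ∀ δ > 0, ∃ K, ∀ i,
      |Real.log (H (i + 1)) - w * Real.log (H i)| ≤ δ * Real.log (H i) + K) :
    ∀ᶠ i in atTop, M ^ 2 * H i < H (i + 1) := by
  have hM := S.one_le_const
  obtain ⟨K, hK⟩ := hgrow 1 one_pos
  filter_upwards [tendsto_natCast_atTop_atTop.eventually_gt_atTop (2 * Real.log M + K)] with i hi
  have hH := S.one_le i
  have hH' := S.one_le (i + 1)
  rw [← Real.log_lt_log_iff (by positivity) (by positivity),
    Real.log_mul (by positivity) (by positivity), Real.log_pow]
  push_cast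
  have h1 := (abs_le.mp (hK i)).1
  have h2 := hlow i
  have h3 : (0 : ℝ) ≤ i := Nat.cast_nonneg i
  nlinarith

theorem tendsto_ceil (S : ApproxSystem b a ξ M k H)
    (hlow : ∀ i : ℕ, (i : ℝ) ≤ Real.log (H i)) :
    Tendsto (fun i => ⌈M * H i⌉₊) atTop atTop := by
  refine tendsto_atTop_mono (fun i => ?_) tendsto_id
  have hM := S.one_le_const
  have hH := S.one_le i
  have h1 := Nat.le_ceil (M * H i)
  have h2 := hlow i
  have h3 := Real.log_le_sub_one_of_pos (show 0 < H i by linarith)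
  have h4 : (i : ℝ) ≤ ⌈M * H i⌉₊ := by nlinarith
  exact_mod_cast h4

theorem mahlerExp_eq (S : ApproxSystem b a ξ M k H) (hw : 4 < w)
    (hw2 : 0 < w ^ 2 - 5 * w + 2) (hlow : ∀ i : ℕ, (i : ℝ) ≤ Real.log (H i))
    (hgrow : ∀ δ > 0, ∃ K, ∀ i,
      |Real.log (H (i + 1)) - w * Real.log (H i)| ≤ δ * Real.log (H i) + K) :
    mahlerExp 2 ξ = (w : EReal) := by
  have hM := S.one_le_const
  have hP0 : ∀ P : F[X][X], P.eval₂ (polyToLaurent F) ξ ≠ 0 → P ≠ 0 := by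
    rintro P hP rfl
    exact hP (eval₂_zero _ _)
  refine limsup_div_log_eq (fun δ hδ => ?_) (fun δ hδ => ?_)
  · obtain ⟨K, hK0, hK⟩ := S.exists_mahler_lower hw hw2 hlow hgrow hδ
    refine ⟨K, fun n hn => ?_⟩
    have hn' : (1 : ℝ) ≤ n := by exact_mod_cast hn
    have hlog := Real.log_nonneg hn'
    rw [← one_mul (mahlerMin 2 ξ n)]
    refine neg_log_mul_sInf_le one_pos (by positivity) ?_
    rintro r ⟨P, hPh, hPd, hPe, rfl⟩
    rw [one_mul]
    exact hK P (hP0 P hPe) hPd n hn' hPh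
  · obtain ⟨K, hK⟩ := hgrow δ hδ
    -- The exponent w + 1 is crude: it only keeps the values away from 0, so that the infimum is
    -- positive.
    obtain ⟨K', -, hK'⟩ := S.exists_mahler_lower hw hw2 hlow hgrow one_pos
    refine ⟨K + w * Real.log (2 * M) + Real.log M, fun i => ⌈M * H i⌉₊, S.tendsto_ceil hlow,
      Eventually.of_forall fun i => ?_⟩
    have hn1 : (1 : ℝ) ≤ ⌈M * H i⌉₊ := S.one_le_ceil i
    have h1 : Real.log (1 * mahlerMin 2 ξ ⌈M * H i⌉₊) ≤
        Real.log (1 * laurentAbs F ((quadPoly b a (k i)).eval₂ (polyToLaurent F) ξ)) := by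
      refine log_mul_sInf_le one_pos
        (Real.exp_pos (-((w + 1) * Real.log ⌈M * H i⌉₊ + K'))) ?_
        ⟨quadPoly b a (k i), (S.height_quadPoly_le i).trans (Nat.le_ceil _),
          quadPoly_natDegree_le _ _ _, (laurentAbs F).ne_zero_iff.mp (S.eval_pos i).ne', rfl⟩
      rintro r ⟨P, hPh, hPd, hPe, rfl⟩
      exact hK' P (hP0 P hPe) hPd _ hn1 hPh
    have h2 := Real.log_le_log (S.eval_pos i) (S.eval_le i)
    rw [one_mul, one_mul] at h1
    have h3 := S.log_value_le hw hδ (hK i)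
    linarith

theorem koksmaExp_eq (S : ApproxSystem b a ξ M k H) (hw : 4 < w)
    (hw2 : 0 < w ^ 2 - 5 * w + 2) (hlow : ∀ i : ℕ, (i : ℝ) ≤ Real.log (H i))
    (hgrow : ∀ δ > 0, ∃ K, ∀ i,
      |Real.log (H (i + 1)) - w * Real.log (H i)| ≤ δ * Real.log (H i) + K) :
    koksmaExp 2 ξ = ((w - 1 : ℝ) : EReal) := by
  have hM := S.one_le_const
  refine limsup_div_log_eq (fun δ hδ => ?_) (fun δ hδ => ?_)
  · obtain ⟨K, hK0, hK⟩ := S.exists_koksma_lower hw hw2 hlow hgrow hδ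
    refine ⟨K, fun n hn => ?_⟩
    have hn' : (1 : ℝ) ≤ n := by exact_mod_cast hn
    have hlog := Real.log_nonneg hn'
    refine neg_log_mul_sInf_le (by linarith)
      (add_nonneg (mul_nonneg (by linarith) hlog) hK0) ?_
    rintro r ⟨α, P, hP, hPh, hPd, -, rfl⟩
    have h1 := hK α P hP hPd n hn' hPh
    calc Real.exp (-((w - 1 + δ) * Real.log n + K))
        = n * Real.exp (-((w + δ) * Real.log n + K)) := by
          rw [show -((w - 1 + δ) * Real.log n + K) =
            Real.log n + -((w + δ) * Real.log n + K) by ring, Real.exp_add,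
            Real.exp_log (by linarith)]
      _ ≤ _ := by gcongr
  · obtain ⟨K, hK⟩ := hgrow δ hδ
    obtain ⟨K', -, hK'⟩ := S.exists_koksma_lower hw hw2 hlow hgrow one_pos
    refine ⟨K + w * Real.log (2 * M) + Real.log M, fun i => ⌈M * H i⌉₊, S.tendsto_ceil hlow, ?_⟩
    filter_upwards [S.eventually_lt hw hlow hgrow] with i hi
    have hn1 : (1 : ℝ) ≤ ⌈M * H i⌉₊ := S.one_le_ceil i
    obtain ⟨α, hα, hclose⟩ := S.exists_close_root hi
    have hne : ξ ≠ α := by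
      rintro rfl
      exact (S.eval_pos i).ne' (by rw [hα, map_zero])
    have hmin : IsMinPoly (monicQuadPoly b a (k i)) (algebraMap (LaurentSeries F) _ α) := by
      refine isMinPoly_monicQuadPoly S.degree_pos a (k i) ?_
      rw [polyToAlg, ← hom_eval₂, hα, map_zero]
    have hdeg : (monicQuadPoly b a (k i)).natDegree ≤ 2 := by
      rw [monicQuadPoly]
      exact (natDegree_C_mul_le _ _).trans (quadPoly_natDegree_le _ _ _)
    have h1 : Real.log (⌈M * H i⌉₊ * koksmaMin 2 ξ ⌈M * H i⌉₊) ≤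
        Real.log (⌈M * H i⌉₊ * laurentAbs F (ξ - α)) := by
      refine log_mul_sInf_le (by linarith)
        (Real.exp_pos (-((w + 1) * Real.log ⌈M * H i⌉₊ + K'))) ?_
        ⟨_, _, hmin, (S.height_monicQuadPoly_le i).trans (Nat.le_ceil _), hdeg,
          fun h => hne ((algebraMap _ _).injective h).symm, ?_⟩
      · rintro r ⟨α, P, hP, hPh, hPd, -, rfl⟩
        exact hK' α P hP hPd _ hn1 hPh
      · rw [← map_sub, algAbs_algebraMap]
    have hpos := laurentAbs_pos (sub_ne_zero.mpr hne)
    rw [Real.log_mul (by linarith) hpos.ne'] at h1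
    have h2 := Real.log_le_log hpos hclose
    have h3 := S.log_value_le hw hδ (hK i)
    linarith

end ApproxSystem

end

end LaurentApprox

/-! ### The main theorem -/

open Polynomial in
theorem theorem1p1 {F : Type*} [Field F] [Finite F] (p : ℕ) [CharP F p] (w : ℝ)
    (hodd : p ≠ 2 → (5 + √17) / 2 < w) (htwo : p = 2 → (9 + √65) / 2 < w)
    (b c : F[X]) (hbc : b ≠ c) (hb : 1 ≤ b.natDegree) (hc : 1 ≤ c.natDegree) :
    ∃ ξ : LaurentSeries F, LaurentApprox.HasContFrac (LaurentApprox.partialQuot w b c) ξ ∧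
      LaurentApprox.koksmaExp 2 ξ = ((w - 1 : ℝ) : EReal) ∧
      LaurentApprox.mahlerExp 2 ξ = (w : EReal) ∧
      LaurentApprox.mahlerExp 2 ξ - LaurentApprox.koksmaExp 2 ξ = 1 := by
  have h17 : √17 ^ 2 = 17 := Real.sq_sqrt (by norm_num)
  have h17' : 4 < √17 := Real.lt_sqrt_of_sq_lt (by norm_num)
  have hw17 : (5 + √17) / 2 < w := by
    by_cases hp : p = 2
    · have h65 : √17 ≤ √65 := Real.sqrt_le_sqrt (by norm_num)
      linarith [htwo hp]
    · exact hodd hp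
  have hw : 4 < w := by linarith
  -- (5 + √17) / 2 is the larger root of x² - 5x + 2.
  have hw2 : 0 < w ^ 2 - 5 * w + 2 := by nlinarith
  obtain ⟨ξ, M, k, H, hconv, S, hlow, hgrow⟩ := LaurentApprox.exists_approxSystem hw hbc hb hc
  have hK := S.koksmaExp_eq hw hw2 hlow hgrow
  have hM := S.mahlerExp_eq hw hw2 hlow hgrow
  refine ⟨ξ, hconv, hK, hM, ?_⟩
  rw [hK, hM, ← EReal.coe_sub, sub_sub_cancel, EReal.coe_one]
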